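/- **Conventions.** Let $n\ge 1$. Cubes $Q\subset\mathbb R^n$ are closed with sides parallel to the axes and sidelength $\ell(Q)>0$; $d$ is the Euclidean distance, $f_Q=\frac1{|Q|}\int_Q f$, and $\log$ is to base $2$. For an open set $\mathcal O\subset\mathbb R^n$ and $f:\mathcal O\to\mathbb R$ in $L^1_{\rm loc}(\mathcal O)$ put $$\omega_{\mathcal O}(f,t)=\sup\Big\{\frac1{|Q|^2}\int_Q\int_Q|f(x)-f(y)|\,dx\,dy\;:\;Q\subset\mathcal O,\ \operatorname{diam}Q\le d(Q,\partial\mathcal O),\ \ell(Q)<t\Big\},$$ and say that $f\in \mathrm{VMO}(\mathcal O)$ if $\omega_{\mathcal O}(f,\cdot)$ is bounded and $\omega_{\mathcal O}(f,t)\to0$ as $t\to0^+$. The BMO norm of $f$ is $\|\omega_{\mathcal O}(f,\cdot)\|_\infty=\sup_t\omega_{\mathcal O}(f,t)$. A modulus of continuity is a bounded nondecreasing function $\eta:[0,\infty)\to[0,\infty)$, continuous at $0$, with $\eta(0)=0$. Distinct cubes are *adjacent* if they intersect. A *Whitney decomposition* of an open set $\mathcal O\subsetneq\mathbb R^n$ is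 a collection of dyadic cubes with pairwise disjoint interiors and union $\mathcal O$, such that $\ell(S)\le d(S,\mathcal O^c)\le 4\sqrt n\,\ell(S)$ for every cube $S$ of the collection and $\frac14\ell(S)\le\ell(T)\le4\ell(S)$ for adjacent cubes $S,T$ of the collection. Let $\Omega\subset\mathbb R^n$ be a bounded domain (nonempty, open, connected), and let $E$, $E'$ be Whitney decompositions of $\Omega$ and of $\overline\Omega^{\,c}$. For $Q_1,Q_2\in E$ let $d_1(Q_1,Q_2)$ be the least $m$ for which there are $S_0=Q_1,S_1,\dots,S_m=Q_2$ in $E$ with $S_i,S_{i+1}$ adjacent for $0\le i<m$, and let $$d_2(Q_1,Q_2)=\Big|\log\frac{\ell(Q_1)}{\ell(Q_2)}\Big|+\log\Big(2+\frac{d(Q_1,Q_2)}{\ell(Q_1)+\ell(Q_2)}\Big).$$ $\Omega$ satisfies the Jones condition with constant $\kappa>0$ if $d_1(Q_1,Q_2)\le\kappa\,d_2(Q_1,Q_2)$ for all $Q_1,Q_2\in E$. Let $L=\max_{S\in E}\ell(S)$, $$\Omega'=\bigcup\{S'\in E':\ell(S')\le L\},\qquad \widetilde\Omega=(\overline\Omega\cup\Omega')^{\rm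 o},$$ where $X^{\rm o}$ is the interior of $X$; $\mathrm{VMO}(\Omega')$ and $\omega_{\Omega'}$ refer to the interior of $\Omega'$. For $S'\in E'$ with $\ell(S')\le L$, a *matching cube* of $S'$ is a cube $S\in E$ that is nearest to $S'$ among the cubes of $E$ with sidelength at least $\ell(S')$. **Proposition.** Let $\Omega$ satisfy the Jones condition with constant $\kappa$, let $\phi_1\in\mathrm{VMO}(\Omega)$ and $\phi_2\in\mathrm{VMO}(\Omega')$ (with $\phi_2$ defined on all of $\Omega'$), and let $\eta$ be a modulus of continuity such that for each $S'\in E'$ with $S'\subset\Omega'$ there is a matching cube $S\in E$ of $S'$ with $$|(\phi_1)_S-(\phi_2)_{S'}|\le\eta(\ell(S')).$$ Let $\Phi=\phi_1$ on $\Omega$, $\Phi=\phi_2$ on $\Omega'$, with arbitrary real values on $\widetilde\Omega\setminus(\Omega\cup\Omega')\subset\partial\Omega$. Then $\Phi\in\mathrm{VMO}(\widetilde\Omega)$ and $$\|\omega_{\widetilde\Omega}(\Phi,\cdot)\|_\infty\le C\big(\|\omega_\Omega(\phi_1,\cdot)\|_\infty+\|\omega_{\Omega'}(\phi_2,\cdot)\|_\infty+\|\eta\|_\infty\big),$$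 with a constant $C>0$ that depends only on $n$ and $\kappa$. -/

import Mathlib

open MeasureTheory Set Filter
open scoped ENNReal NNReal Topology

noncomputable section

namespace WhitneyVMO

/-- A (closed, nondegenerate) cube in `ℝⁿ` with sides parallel to the coordinate axes, given by its
lower corner and its sidelength. -/
@[ext]
structure Cube (n : ℕ) where
  corner : EuclideanSpace ℝ (Fin n)
  side : ℝ
  side_pos : 0 < side

/-- The point set of a cube. -/
def Cube.toSet {n : ℕ} (Q : Cube n) : Set (EuclideanSpace ℝ (Fin n)) :=
  {x | ∀ i, Q.corner i ≤ x i ∧ x i ≤ Q.corner i + Q.side}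

/-- A cube is dyadic if its sidelength is `2 ^ k`, `k ∈ ℤ`, and its vertices lie in `2 ^ k ℤⁿ`. -/
def Cube.IsDyadic {n : ℕ} (Q : Cube n) : Prop :=
  ∃ k : ℤ, Q.side = (2 : ℝ) ^ k ∧ ∀ i, ∃ m : ℤ, Q.corner i = (m : ℝ) * (2 : ℝ) ^ k

/-- The Euclidean distance between two (nonempty) sets. -/
def setDist {n : ℕ} (A B : Set (EuclideanSpace ℝ (Fin n))) : ℝ :=
  sInf (image2 dist A B)

/-- Two cubes are adjacent (touch) if they are distinct and have a common point. -/
def Adjacent {n : ℕ} (Q R : Cube n) : Prop :=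
  Q ≠ R ∧ (Q.toSet ∩ R.toSet).Nonempty

/-- `E` is a dyadic Whitney decomposition of `O`. -/
structure IsWhitney {n : ℕ} (O : Set (EuclideanSpace ℝ (Fin n))) (E : Set (Cube n)) : Prop where
  dyadic : ∀ Q ∈ E, Q.IsDyadic
  union_eq : ⋃ Q ∈ E, Q.toSet = O
  disjoint_interior : ∀ Q ∈ E, ∀ R ∈ E, Q ≠ R → Disjoint (interior Q.toSet) (interior R.toSet)
  side_le_dist : ∀ Q ∈ E, Q.side ≤ setDist Q.toSet Oᶜ
  dist_le_side : ∀ Q ∈ E, setDist Q.toSet Oᶜ ≤ 4 * √(n : ℝ) * Q.side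
  adjacent_le : ∀ Q ∈ E, ∀ R ∈ E, Adjacent Q R →
    1 / 4 * Q.side ≤ R.side ∧ R.side ≤ 4 * Q.side

/-- `c 0, …, c m` is a Whitney chain of length `m` in `E` connecting `Q` and `R`. -/
def IsWhitneyChain {n : ℕ} (E : Set (Cube n)) (Q R : Cube n) (m : ℕ) (c : ℕ → Cube n) : Prop :=
  c 0 = Q ∧ c m = R ∧ (∀ i ≤ m, c i ∈ E) ∧ ∀ i < m, Adjacent (c i) (c (i + 1))

/-- The length of a shortest Whitney chain connecting two cubes (`⊤` if there is none). -/
def d₁ {n : ℕ} (E : Set (Cube n)) (Q R : Cube n) : ℕ∞ :=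
  ⨅ (m : ℕ) (_ : ∃ c, IsWhitneyChain E Q R m c), (m : ℕ∞)

/-- `d₂(Q, R) = |log (ℓ(Q) / ℓ(R))| + log (2 + d(Q, R) / (ℓ(Q) + ℓ(R)))`, logarithms to base 2. -/
def d₂ {n : ℕ} (Q R : Cube n) : ℝ :=
  |Real.logb 2 (Q.side / R.side)|
    + Real.logb 2 (2 + setDist Q.toSet R.toSet / (Q.side + R.side))

/-- The Jones condition with constant `κ`, for a Whitney decomposition `E`. -/
def JonesCondition {n : ℕ} (κ : ℝ) (E : Set (Cube n)) : Prop :=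
  ∀ Q ∈ E, ∀ R ∈ E, (d₁ E Q R : ℝ≥0∞) ≤ ENNReal.ofReal (κ * d₂ Q R)

/-- The largest sidelength of a cube of `E`. -/
def maxSide {n : ℕ} (E : Set (Cube n)) : ℝ :=
  sSup (Cube.side '' E)

/-- `S` is a matching cube of `S'`: a nearest one to `S'` among the cubes of `E` of sidelength
at least `ℓ(S')`. -/
def IsMatching {n : ℕ} (E : Set (Cube n)) (S' S : Cube n) : Prop :=
  S ∈ E ∧ S'.side ≤ S.side ∧
    ∀ T ∈ E, S'.side ≤ T.side → setDist S.toSet S'.toSet ≤ setDist T.toSet S'.toSet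

/-- The union `Ω'` of the cubes of `E'` whose sidelength is at most the largest one in `E`. -/
def smallExterior {n : ℕ} (E E' : Set (Cube n)) : Set (EuclideanSpace ℝ (Fin n)) :=
  ⋃ S' ∈ {S' ∈ E' | S'.side ≤ maxSide E}, S'.toSet

/-- The enlarged set, the interior of the union of the closure of `Ω` with `Ω'`. -/
def enlarged {n : ℕ} (Ω : Set (EuclideanSpace ℝ (Fin n))) (E E' : Set (Cube n)) :
    Set (EuclideanSpace ℝ (Fin n)) :=
  interior (closure Ω ∪ smallExterior E E')

/-- Interior cubes of an open set `O`: `Q ⊆ O` and `diam Q ≤ d(Q, ∂O)`. -/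
def IsInteriorCube {n : ℕ} (O : Set (EuclideanSpace ℝ (Fin n))) (Q : Cube n) : Prop :=
  Q.toSet ⊆ O ∧ ∀ x ∈ Q.toSet, ∀ y ∈ frontier O, Metric.diam Q.toSet ≤ dist x y

/-- The mean oscillation `|Q|⁻² ∫_Q ∫_Q |f(x) - f(y)| dx dy`. -/
def meanOsc {n : ℕ} (f : EuclideanSpace ℝ (Fin n) → ℝ) (Q : Cube n) : ℝ≥0∞ :=
  (∫⁻ x in Q.toSet, ∫⁻ y in Q.toSet, ENNReal.ofReal |f x - f y|) / volume Q.toSet ^ 2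

/-- The modulus of mean oscillation `ω_O(f, t)`. -/
def oscModulus {n : ℕ} (O : Set (EuclideanSpace ℝ (Fin n))) (f : EuclideanSpace ℝ (Fin n) → ℝ)
    (t : ℝ) : ℝ≥0∞ :=
  ⨆ (Q : Cube n) (_ : IsInteriorCube O Q) (_ : Q.side < t), meanOsc f Q

/-- The supremum norm of `t ↦ ω_O(f, t)`. -/
def oscNorm {n : ℕ} (O : Set (EuclideanSpace ℝ (Fin n))) (f : EuclideanSpace ℝ (Fin n) → ℝ) :
    ℝ≥0∞ :=
  ⨆ t : ℝ, oscModulus O f t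

/-- `f ∈ VMO(O)` for an open, not necessarily connected set `O`: `f` is locally integrable on `O`,
and its modulus of mean oscillation is bounded and tends to `0` at `0`. -/
structure IsVMO {n : ℕ} (O : Set (EuclideanSpace ℝ (Fin n)))
    (f : EuclideanSpace ℝ (Fin n) → ℝ) : Prop where
  locallyIntegrable : LocallyIntegrableOn f O volume
  bounded : oscNorm O f < ⊤
  vanishing : Tendsto (oscModulus O f) (𝓝[>] 0) (𝓝 0)

/-- Moduli of continuity: bounded nondecreasing `η : [0, ∞) → [0, ∞)`, continuous at `0`, with
`η 0 = 0`. -/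
structure IsModulusOfContinuity (η : ℝ≥0 → ℝ≥0) : Prop where
  bounded : BddAbove (range η)
  monotone : Monotone η
  continuousAt_zero : ContinuousAt η 0
  map_zero : η 0 = 0

end WhitneyVMO

end

open WhitneyVMO

/-! A cube Q of the enlarged domain that meets ∂Ω is tested against a reference Whitney cube S(Q) of
Ω whose size and distance from Q are comparable to ℓ(Q). It exists because the Jones condition makes
∂Ω porous from inside: pieces of shortest chains between cubes of comparable size have bounded
length unless they pass through much larger cubes. So chains reach larger cubes at a geometric rate,
and Whitney cubes of size about r occur within r of every boundary point (`exists_near_large_cube`,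
`exists_cube_near_frontier`).

Let F(Q) be the mean of |f(x) - f(y)| over Q × S(Q); the mean oscillation over Q is at most 2F(Q).
Cut Q into M = N^n equal cells. A cell missing ∂Ω lies in Ω or in the exterior. It is linked to S(Q)
by boundedly many comparisons: with the Whitney cube at its centre, for an exterior cell also with
the matching cube of that one, then along a bounded chain in Ω. This costs a multiple of W, a common
bound for the oscillations inside and outside and for the mean differences of matching cubes, at a
comparable scale. A cell P meeting ∂Ω costs F(P) plus a bounded chain from S(P) to S(Q). For N
large, porosity leaves one cell off ∂Ω, so σ = sup F satisfies Mσ ≤ (M - 1)σ + CMW, and σ is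
absorbed (`self_improvement`). Absorption needs σ finite: truncation provides this and Fatou's lemma
removes it.

The same absorption is used twice more. Applied to the density of ∂Ω in cubes it gives |∂Ω| = 0, so
the values of Φ there do not matter. Applied to the mean difference between a cube and its central
cell it passes from the interior cubes in the definition of ω to arbitrary cubes. The final estimate
compares scale t with scale Kt, which yields both the norm bound and the vanishing. -/

namespace WhitneyVMO

noncomputable section

/-! ### Mean differences between sets: triangle inequality and overlap. -/

section MeanDifference

variable {X : Type*} [MeasureSpace X]

/-- Sets of positive finite measure. -/
structure FinPos (A : Set X) : Prop where
  ne_zero : volume A ≠ 0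
  ne_top : volume A ≠ ⊤

/-- The mean difference of `f` between two sets `A` and `B`. -/
def meanDiff (f : X → ℝ) (A B : Set X) : ℝ≥0∞ :=
  (∫⁻ x in A, ∫⁻ y in B, ENNReal.ofReal |f x - f y|) / (volume A * volume B)

theorem measurable_ofReal_abs_sub {f : X → ℝ} (hf : Measurable f) :
    Measurable fun p : X × X => ENNReal.ofReal |f p.1 - f p.2| :=
  ((hf.comp measurable_fst).sub (hf.comp measurable_snd)).abs.ennreal_ofReal

theorem ofReal_abs_sub_triangle (a b c : ℝ) :
    ENNReal.ofReal |a - c| ≤ ENNReal.ofReal |a - b| + ENNReal.ofReal |b - c| := by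
  rw [← ENNReal.ofReal_add (abs_nonneg _) (abs_nonneg _)]
  exact ENNReal.ofReal_le_ofReal (abs_sub_le _ _ _)

theorem meanDiff_congr {f g : X → ℝ} {A B : Set X} (hA : f =ᵐ[volume.restrict A] g)
    (hB : f =ᵐ[volume.restrict B] g) : meanDiff f A B = meanDiff g A B := by
  unfold meanDiff
  congr 1
  refine lintegral_congr_ae ?_
  filter_upwards [hA] with x hx
  refine lintegral_congr_ae ?_
  filter_upwards [hB] with y hy
  rw [hx, hy]

theorem meanDiff_mono_fun {f g : X → ℝ} (h : ∀ x y, |g x - g y| ≤ |f x - f y|) (A B : Set X) :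
    meanDiff g A B ≤ meanDiff f A B := by
  unfold meanDiff
  refine ENNReal.div_le_div_right (lintegral_mono fun x => lintegral_mono fun y => ?_) _
  exact ENNReal.ofReal_le_ofReal (h _ _)

theorem meanDiff_mono_left {f : X → ℝ} {A A' : Set X} (B : Set X) {c : ℝ≥0∞} (hAA : A ⊆ A')
    (hA : FinPos A) (hA' : FinPos A') (hc : volume A' ≤ c * volume A) :
    meanDiff f A B ≤ c * meanDiff f A' B := by
  unfold meanDiff
  have h1 : (volume A)⁻¹ ≤ c * (volume A')⁻¹ := by
    rw [← div_eq_mul_inv, ENNReal.le_div_iff_mul_le (Or.inl hA'.ne_zero) (Or.inl hA'.ne_top)]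
    calc (volume A)⁻¹ * volume A' ≤ (volume A)⁻¹ * (c * volume A) := by gcongr
      _ = c * ((volume A)⁻¹ * volume A) := by ring
      _ = c := by rw [ENNReal.inv_mul_cancel hA.ne_zero hA.ne_top, mul_one]
  rw [div_eq_mul_inv, div_eq_mul_inv, ENNReal.mul_inv (Or.inl hA.ne_zero) (Or.inl hA.ne_top),
    ENNReal.mul_inv (Or.inl hA'.ne_zero) (Or.inl hA'.ne_top)]
  calc _ ≤ (∫⁻ x in A', ∫⁻ y in B, ENNReal.ofReal |f x - f y|)
        * (c * (volume A')⁻¹ * (volume B)⁻¹) := by gcongr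
    _ = _ := by ring

/-- As the pieces all have measure |A| / card ι, their mean differences share one normalisation, and
only subadditivity of the integral over the cover remains. -/
theorem card_mul_meanDiff_le_sum {ι : Type*} [Fintype ι] {f : X → ℝ} {A : Set X}
    {a : ι → Set X} (B : Set X) (hA : FinPos A)
    (hcov : A ⊆ ⋃ i, a i) (ha : ∀ i, volume A = Fintype.card ι * volume (a i)) :
    Fintype.card ι * meanDiff f A B ≤ ∑ i, meanDiff f (a i) B := by
  have hc0 : (Fintype.card ι : ℝ≥0∞) ≠ 0 := by
    intro h
    rcases isEmpty_or_nonempty ι with hι | ⟨⟨i⟩⟩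
    · refine hA.ne_zero (le_antisymm ((measure_mono hcov).trans ?_) bot_le)
      simp
    · exact hA.ne_zero (by rw [ha i, h, zero_mul])
  have hct : (Fintype.card ι : ℝ≥0∞) ≠ ⊤ := ENNReal.natCast_ne_top _
  have h1 : ∀ i, meanDiff f (a i) B = Fintype.card ι *
      ((∫⁻ x in a i, ∫⁻ y in B, ENNReal.ofReal |f x - f y|) / (volume A * volume B)) := by
    intro i
    unfold meanDiff
    rw [ha i, div_eq_mul_inv, div_eq_mul_inv, mul_assoc (Fintype.card ι : ℝ≥0∞),
      ENNReal.mul_inv (Or.inl hc0) (Or.inl hct)]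
    calc _ = ((Fintype.card ι : ℝ≥0∞) * (Fintype.card ι : ℝ≥0∞)⁻¹) *
          ((∫⁻ x in a i, ∫⁻ y in B, ENNReal.ofReal |f x - f y|) *
            (volume (a i) * volume B)⁻¹) := by rw [ENNReal.mul_inv_cancel hc0 hct, one_mul]
      _ = _ := by ring
  simp_rw [h1]
  rw [← Finset.mul_sum]
  gcongr
  unfold meanDiff
  simp_rw [div_eq_mul_inv]
  rw [← Finset.sum_mul]
  gcongr
  calc _ ≤ ∫⁻ x in ⋃ i, a i, ∫⁻ y in B, ENNReal.ofReal |f x - f y| :=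
        lintegral_mono_set hcov
    _ ≤ _ := (lintegral_iUnion_le _ _).trans (by rw [tsum_fintype])

variable [SFinite (volume : Measure X)]

theorem meanDiff_comm {f : X → ℝ} (hf : Measurable f) (A B : Set X) :
    meanDiff f A B = meanDiff f B A := by
  unfold meanDiff
  rw [lintegral_lintegral_swap (measurable_ofReal_abs_sub hf).aemeasurable, mul_comm]
  simp only [abs_sub_comm]

/-- The pointwise triangle inequality is integrated over A × B × C and divided by the three
measures. -/
theorem meanDiff_triangle {f : X → ℝ} (hf : Measurable f) {A B C : Set X} (hA : FinPos A)
    (hB : FinPos B) (hC : FinPos C) :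
    meanDiff f A C ≤ meanDiff f A B + meanDiff f B C := by
  have hm := measurable_ofReal_abs_sub hf
  have hm1 : ∀ x, Measurable fun y => ENNReal.ofReal |f x - f y| := fun x =>
    hm.comp measurable_prodMk_left
  have hm2 : ∀ z, Measurable fun y => ENNReal.ofReal |f y - f z| := fun x =>
    hm.comp measurable_prodMk_right
  have hmB : Measurable fun x => ∫⁻ y in B, ENNReal.ofReal |f x - f y| :=
    hm.lintegral_prod_right'
  have key : (∫⁻ x in A, ∫⁻ z in C, ENNReal.ofReal |f x - f z|) * volume B ≤
      (∫⁻ x in A, ∫⁻ y in B, ENNReal.ofReal |f x - f y|) * volume C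
        + volume A * (∫⁻ y in B, ∫⁻ z in C, ENNReal.ofReal |f y - f z|) := by
    have h1 : ∀ x z, ENNReal.ofReal |f x - f z| * volume B ≤
        (∫⁻ y in B, ENNReal.ofReal |f x - f y|) + ∫⁻ y in B, ENNReal.ofReal |f y - f z| := by
      intro x z
      rw [← lintegral_add_left (hm1 x), ← setLIntegral_const]
      exact lintegral_mono fun y => ofReal_abs_sub_triangle _ _ _
    have h2 : ∀ x, (∫⁻ z in C, ENNReal.ofReal |f x - f z|) * volume B ≤
        (∫⁻ y in B, ENNReal.ofReal |f x - f y|) * volume C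
          + ∫⁻ y in B, ∫⁻ z in C, ENNReal.ofReal |f y - f z| := by
      intro x
      rw [lintegral_lintegral_swap hm.aemeasurable, ← lintegral_mul_const _ (hm1 x),
        ← setLIntegral_const, ← lintegral_add_left measurable_const]
      exact lintegral_mono fun z => h1 x z
    rw [← lintegral_mul_const _ hm.lintegral_prod_right', ← lintegral_mul_const _ hmB,
      mul_comm (volume A), ← setLIntegral_const, ← lintegral_add_left (hmB.mul_const _)]
    exact lintegral_mono fun x => h2 x
  unfold meanDiff
  set a := volume A
  set b := volume B
  set c := volume C
  have hAC0 : a * c ≠ 0 := mul_ne_zero hA.ne_zero hC.ne_zero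
  have hACt : a * c ≠ ⊤ := ENNReal.mul_ne_top hA.ne_top hC.ne_top
  rw [ENNReal.div_le_iff hAC0 hACt, add_mul]
  have e1 : ∀ u : ℝ≥0∞, u / (a * b) * (a * c) = u * c * b⁻¹ := fun u => by
    rw [div_eq_mul_inv, ENNReal.mul_inv (Or.inl hA.ne_zero) (Or.inl hA.ne_top)]
    calc _ = (a⁻¹ * a) * (u * c * b⁻¹) := by ring
      _ = _ := by rw [ENNReal.inv_mul_cancel hA.ne_zero hA.ne_top, one_mul]
  have e2 : ∀ u : ℝ≥0∞, u / (b * c) * (a * c) = a * u * b⁻¹ := fun u => by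
    rw [div_eq_mul_inv, ENNReal.mul_inv (Or.inl hB.ne_zero) (Or.inl hB.ne_top)]
    calc _ = (c⁻¹ * c) * (a * u * b⁻¹) := by ring
      _ = _ := by rw [ENNReal.inv_mul_cancel hC.ne_zero hC.ne_top, one_mul]
  rw [e1, e2, ← add_mul, ← div_eq_mul_inv,
    ENNReal.le_div_iff_mul_le (Or.inl hB.ne_zero) (Or.inl hB.ne_top)]
  exact key

theorem meanDiff_mono_right {f : X → ℝ} (hf : Measurable f) {A A' : Set X} (B : Set X) {c : ℝ≥0∞}
    (hAA : A ⊆ A') (hA : FinPos A) (hA' : FinPos A') (hc : volume A' ≤ c * volume A) :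
    meanDiff f B A ≤ c * meanDiff f B A' := by
  rw [meanDiff_comm hf, meanDiff_comm hf B A']
  exact meanDiff_mono_left B hAA hA hA' hc

/-- Sets with a common part of substantial measure have a small mean difference. -/
theorem meanDiff_le_of_common {f : X → ℝ} (hf : Measurable f) {A B I : Set X} {c : ℝ≥0∞}
    (hIA : I ⊆ A) (hIB : I ⊆ B) (hA : FinPos A) (hB : FinPos B) (hI : FinPos I)
    (hcA : volume A ≤ c * volume I) (hcB : volume B ≤ c * volume I) :
    meanDiff f A B ≤ c * (meanDiff f A A + meanDiff f B B) := by
  rw [mul_add]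
  exact (meanDiff_triangle hf hA hI hB).trans (add_le_add
    (meanDiff_mono_right hf A hIA hI hA hcA) (meanDiff_mono_left B hIB hI hB hcB))

theorem meanDiff_self_le {f : X → ℝ} (hf : Measurable f) {A B : Set X} (hA : FinPos A)
    (hB : FinPos B) : meanDiff f A A ≤ 2 * meanDiff f A B := by
  rw [two_mul]
  nth_rewrite 3 [meanDiff_comm hf]
  exact meanDiff_triangle hf hA hB hA

end MeanDifference

/-! ### Truncation, the source of a priori finiteness. -/

section Truncation

variable {X : Type*}

/-- The truncation of `f` at height `k`. -/
def truncate (k : ℕ) (f : X → ℝ) (x : X) : ℝ := max (-(k : ℝ)) (min (k : ℝ) (f x))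

theorem abs_truncate_le (k : ℕ) (f : X → ℝ) (x : X) : |truncate k f x| ≤ k := by
  have hk : (0 : ℝ) ≤ k := k.cast_nonneg
  rw [abs_le]
  exact ⟨le_max_left _ _, max_le (by linarith) (min_le_left _ _)⟩

theorem abs_truncate_sub_le (k : ℕ) (f : X → ℝ) (x y : X) :
    |truncate k f x - truncate k f y| ≤ |f x - f y| := by
  unfold truncate
  refine (abs_max_sub_max_le_max _ _ _ _).trans ?_
  simp only [sub_self, abs_zero]
  refine max_le (abs_nonneg _) ((abs_min_sub_min_le_max _ _ _ _).trans ?_)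
  simp

theorem truncate_eq_of_le {k : ℕ} {f : X → ℝ} {x : X} (h : |f x| ≤ k) : truncate k f x = f x := by
  rw [abs_le] at h
  simp [truncate, h.1, h.2]

theorem measurable_truncate [MeasurableSpace X] (k : ℕ) {f : X → ℝ} (hf : Measurable f) :
    Measurable (truncate k f) :=
  measurable_const.max (measurable_const.min hf)

variable [MeasureSpace X]

theorem meanDiff_truncate_le (k : ℕ) (f : X → ℝ) (A B : Set X) :
    meanDiff (truncate k f) A B ≤ meanDiff f A B :=
  meanDiff_mono_fun (abs_truncate_sub_le k f) A B

theorem meanDiff_le_of_abs_le {f : X → ℝ} {k : ℝ} (hk : ∀ x, |f x| ≤ k) (A B : Set X) :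
    meanDiff f A B ≤ ENNReal.ofReal (2 * k) := by
  unfold meanDiff
  refine ENNReal.div_le_of_le_mul ?_
  calc _ ≤ ∫⁻ _x in A, ∫⁻ _y in B, ENNReal.ofReal (2 * k) := by
        gcongr with x y
        have := abs_sub (f x) (f y)
        linarith [hk x, hk y]
    _ = _ := by rw [setLIntegral_const, setLIntegral_const]; ring

variable [SFinite (volume : Measure X)]

/-- Fatou's lemma: at each pair of points the truncated difference is eventually the true one. This
allows absorption arguments to be run on bounded functions only. -/
theorem meanDiff_le_of_truncate_le {f : X → ℝ} (hf : Measurable f) {A B : Set X} {K : ℝ≥0∞}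
    (hA : FinPos A) (hB : FinPos B)
    (h : ∀ k, meanDiff (truncate k f) A B ≤ K) : meanDiff f A B ≤ K := by
  have h0 : volume A * volume B ≠ 0 := mul_ne_zero hA.ne_zero hB.ne_zero
  have ht : volume A * volume B ≠ ⊤ := ENNReal.mul_ne_top hA.ne_top hB.ne_top
  have hm : ∀ k, Measurable fun p : X × X =>
      ENNReal.ofReal |truncate k f p.1 - truncate k f p.2| := fun k =>
    measurable_ofReal_abs_sub (measurable_truncate k hf)
  unfold meanDiff at h ⊢
  simp_rw [ENNReal.div_le_iff h0 ht] at h ⊢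
  have e : ∀ g : X → ℝ, Measurable g → (∫⁻ x in A, ∫⁻ y in B, ENNReal.ofReal |g x - g y|) =
      ∫⁻ p, ENNReal.ofReal |g p.1 - g p.2| ∂((volume.restrict A).prod (volume.restrict B)) :=
    fun g hg => (lintegral_prod _ (measurable_ofReal_abs_sub hg).aemeasurable).symm
  rw [e f hf]
  have hl : ∀ p : X × X, ENNReal.ofReal |f p.1 - f p.2| =
      liminf (fun k : ℕ => ENNReal.ofReal |truncate k f p.1 - truncate k f p.2|) atTop := by
    intro p
    refine (Tendsto.liminf_eq ?_).symm
    refine tendsto_const_nhds.congr' ?_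
    obtain ⟨m, hm⟩ := exists_nat_ge (max |f p.1| |f p.2|)
    filter_upwards [eventually_ge_atTop m] with k hk
    have hmk : (m : ℝ) ≤ k := by exact_mod_cast hk
    rw [truncate_eq_of_le ((le_max_left _ _).trans (hm.trans hmk)),
      truncate_eq_of_le ((le_max_right _ _).trans (hm.trans hmk))]
  simp_rw [hl]
  refine (lintegral_liminf_le hm).trans ?_
  refine liminf_le_of_le ?_ ?_
  · isBoundedDefault
  · intro b hb
    obtain ⟨k, hk⟩ := hb.exists
    rw [← e _ (measurable_truncate k hf)] at hk
    exact hk.trans (h k)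

end Truncation

/-! ### Mean differences and averages. -/

section Average

variable {X : Type*} [MeasureSpace X] [SFinite (volume : Measure X)]

/-- By Tonelli, y ↦ f x - f y is integrable on A for some x, and constants are integrable there. -/
theorem integrableOn_of_meanDiff_ne_top {f : X → ℝ} (hf : Measurable f) {A : Set X}
    (hA : FinPos A) (h : meanDiff f A A ≠ ⊤) : IntegrableOn f A := by
  have hJ : (∫⁻ x in A, ∫⁻ y in A, ENNReal.ofReal |f x - f y|) ≠ ⊤ := by
    intro hJ
    refine h ?_
    unfold meanDiff
    rw [hJ, ENNReal.top_div_of_ne_top (ENNReal.mul_ne_top hA.ne_top hA.ne_top)]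
  have hae := ae_lt_top (measurable_ofReal_abs_sub hf).lintegral_prod_right' hJ
  have : NeZero (volume.restrict A) := ⟨by simpa using hA.ne_zero⟩
  obtain ⟨x, hx⟩ := hae.exists
  have : Fact (volume A < ⊤) := ⟨hA.ne_top.lt_top⟩
  have hi : IntegrableOn (fun y => f x - f y) A := by
    refine ⟨(measurable_const.sub hf).aestronglyMeasurable, ?_⟩
    rw [hasFiniteIntegral_iff_norm]
    simpa [Real.norm_eq_abs] using hx
  have := (integrable_const (μ := volume.restrict A) (f x)).sub hi
  refine this.congr (ae_of_all _ fun y => ?_)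
  simp

/-- Turns the hypothesis on averages over matching cubes into a mean difference: f x and f y are
compared through the two averages. -/
theorem meanDiff_le_of_average {f : X → ℝ} (hf : Measurable f) {A B : Set X} (hA : FinPos A)
    (hB : FinPos B) : meanDiff f A B ≤ meanDiff f A A + meanDiff f B B
      + ENNReal.ofReal |(⨍ x in A, f x) - ⨍ x in B, f x| := by
  have key : ∀ A : Set X, FinPos A → meanDiff f A A ≠ ⊤ →
      (∫⁻ x in A, ENNReal.ofReal |f x - ⨍ y in A, f y|) ≤ meanDiff f A A * volume A := by
    intro A hA hAt
    have hi := integrableOn_of_meanDiff_ne_top hf hA hAt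
    have : Fact (volume A < ⊤) := ⟨hA.ne_top.lt_top⟩
    have hA0 : (volume A).toReal ≠ 0 := (ENNReal.toReal_pos hA.ne_zero hA.ne_top).ne'
    have hp : ∀ x, ENNReal.ofReal |f x - ⨍ y in A, f y| ≤
        (∫⁻ y in A, ENNReal.ofReal |f x - f y|) * (volume A)⁻¹ := by
      intro x
      have e1 : f x - ⨍ y in A, f y = (volume A).toReal⁻¹ * ∫ y in A, (f x - f y) := by
        rw [integral_sub (integrable_const _) hi, setAverage_eq]
        simp only [integral_const, Measure.restrict_apply_univ, smul_eq_mul, Measure.real]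
        field_simp
      rw [e1, abs_mul, ENNReal.ofReal_mul (abs_nonneg _), mul_comm,
        abs_of_nonneg (inv_nonneg.2 ENNReal.toReal_nonneg),
        ENNReal.ofReal_inv_of_pos (ENNReal.toReal_pos hA.ne_zero hA.ne_top),
        ENNReal.ofReal_toReal hA.ne_top]
      gcongr
      rw [← Real.norm_eq_abs, ofReal_norm]
      refine (enorm_integral_le_lintegral_enorm _).trans (le_of_eq ?_)
      simp only [← ofReal_norm, Real.norm_eq_abs]
    refine (lintegral_mono hp).trans (le_of_eq ?_)
    rw [lintegral_mul_const _ (measurable_ofReal_abs_sub hf).lintegral_prod_right']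
    unfold meanDiff
    rw [div_eq_mul_inv, ENNReal.mul_inv (Or.inl hA.ne_zero) (Or.inl hA.ne_top)]
    calc _ = (∫⁻ x in A, ∫⁻ y in A, ENNReal.ofReal |f x - f y|) * (volume A)⁻¹
          * ((volume A)⁻¹ * volume A) := by
            rw [ENNReal.inv_mul_cancel hA.ne_zero hA.ne_top, mul_one]
      _ = _ := by ring
  by_cases hAt : meanDiff f A A = ⊤
  · simp [hAt]
  by_cases hBt : meanDiff f B B = ⊤
  · simp [hBt]
  have h1 := key A hA hAt
  have h2 := key B hB hBt
  set a := ⨍ x in A, f x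
  set b := ⨍ x in B, f x
  have h0 : volume A * volume B ≠ 0 := mul_ne_zero hA.ne_zero hB.ne_zero
  have ht : volume A * volume B ≠ ⊤ := ENNReal.mul_ne_top hA.ne_top hB.ne_top
  have hmA : Measurable fun x => ENNReal.ofReal |f x - a| :=
    (hf.sub measurable_const).abs.ennreal_ofReal
  conv_lhs => unfold meanDiff
  rw [ENNReal.div_le_iff h0 ht]
  have h3 : ∀ x, (∫⁻ y in B, ENNReal.ofReal |f x - f y|) ≤
      ENNReal.ofReal |f x - a| * volume B + (ENNReal.ofReal |a - b| * volume B
        + meanDiff f B B * volume B) := by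
    intro x
    calc _ ≤ ∫⁻ y in B, (ENNReal.ofReal |f x - a| + (ENNReal.ofReal |a - b|
          + ENNReal.ofReal |f y - b|)) := by
          refine lintegral_mono fun y => ?_
          refine (ofReal_abs_sub_triangle _ a _).trans (add_le_add le_rfl ?_)
          rw [abs_sub_comm (f y)]
          exact ofReal_abs_sub_triangle _ _ _
      _ = ENNReal.ofReal |f x - a| * volume B + (ENNReal.ofReal |a - b| * volume B
        + ∫⁻ y in B, ENNReal.ofReal |f y - b|) := by
          rw [lintegral_add_left measurable_const, lintegral_add_left measurable_const,
            setLIntegral_const, setLIntegral_const]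
      _ ≤ _ := by gcongr
  calc _ ≤ ∫⁻ x in A, (ENNReal.ofReal |f x - a| * volume B + (ENNReal.ofReal |a - b| * volume B
        + meanDiff f B B * volume B)) := lintegral_mono h3
    _ = (∫⁻ x in A, ENNReal.ofReal |f x - a|) * volume B + (ENNReal.ofReal |a - b| * volume B
        + meanDiff f B B * volume B) * volume A := by
        rw [lintegral_add_left (hmA.mul_const _), setLIntegral_const, lintegral_mul_const _ hmA]
    _ ≤ meanDiff f A A * volume A * volume B + (ENNReal.ofReal |a - b| * volume B
        + meanDiff f B B * volume B) * volume A := by gcongr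
    _ = _ := by ring

end Average

variable {n : ℕ}

/-! ### Elementary geometry of cubes and their subdivisions. -/

section CubeGeometry

theorem dist_le_sqrt_mul {x y : EuclideanSpace ℝ (Fin n)} {a : ℝ} (ha : 0 ≤ a)
    (h : ∀ i, |x i - y i| ≤ a) : dist x y ≤ √n * a := by
  rw [EuclideanSpace.dist_eq]
  calc √(∑ i, dist (x i) (y i) ^ 2) ≤ √(∑ _i : Fin n, a ^ 2) := by
        gcongr with i
        exact h i
    _ = √n * a := by simp [Real.sqrt_mul, Real.sqrt_sq ha]

theorem abs_sub_le_dist (x y : EuclideanSpace ℝ (Fin n)) (i : Fin n) : |x i - y i| ≤ dist x y := by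
  have := PiLp.norm_apply_le (x - y) i
  rwa [← dist_eq_norm] at this

theorem abs_sub_le_side {Q : Cube n} {x y : EuclideanSpace ℝ (Fin n)} (hx : x ∈ Q.toSet)
    (hy : y ∈ Q.toSet) (i : Fin n) : |x i - y i| ≤ Q.side := by
  have h1 := hx i
  have h2 := hy i
  rw [abs_le]
  constructor <;> linarith

theorem Cube.dist_le {Q : Cube n} {x y : EuclideanSpace ℝ (Fin n)} (hx : x ∈ Q.toSet)
    (hy : y ∈ Q.toSet) : dist x y ≤ √n * Q.side :=
  dist_le_sqrt_mul Q.side_pos.le (abs_sub_le_side hx hy)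

theorem Cube.diam_le (Q : Cube n) : Metric.diam Q.toSet ≤ √n * Q.side :=
  Metric.diam_le_of_forall_dist_le (mul_nonneg (Real.sqrt_nonneg _) Q.side_pos.le)
    fun _ hx _ hy => Cube.dist_le hx hy

theorem Cube.toSet_eq_preimage (Q : Cube n) : Q.toSet =
    WithLp.ofLp ⁻¹' (univ.pi fun i => Icc (Q.corner i) (Q.corner i + Q.side)) := by
  ext x
  simp only [Cube.toSet, mem_ofPred_eq, mem_preimage, mem_univ_pi, mem_Icc]

theorem Cube.corner_mem (Q : Cube n) : Q.corner ∈ Q.toSet := fun _ =>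
  ⟨le_rfl, le_add_of_nonneg_right Q.side_pos.le⟩

theorem Cube.isClosed (Q : Cube n) : IsClosed Q.toSet := by
  rw [Q.toSet_eq_preimage]
  exact (isClosed_set_pi fun _ _ => isClosed_Icc).preimage (PiLp.continuous_ofLp 2 _)

theorem Cube.isBounded (Q : Cube n) : Bornology.IsBounded Q.toSet :=
  Metric.isBounded_iff.2 ⟨_, fun _ hx _ hy => Cube.dist_le hx hy⟩

theorem Cube.isCompact (Q : Cube n) : IsCompact Q.toSet :=
  Metric.isCompact_of_isClosed_isBounded Q.isClosed Q.isBounded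

theorem Cube.convex (Q : Cube n) : Convex ℝ Q.toSet := by
  intro x hx y hy a b ha hb hab i
  have h1 := hx i
  have h2 := hy i
  simp only [PiLp.add_apply, PiLp.smul_apply, smul_eq_mul]
  have e1 : Q.corner i = a * Q.corner i + b * Q.corner i := by rw [← add_mul, hab, one_mul]
  have e2 : Q.corner i + Q.side
      = a * (Q.corner i + Q.side) + b * (Q.corner i + Q.side) := by rw [← add_mul, hab, one_mul]
  rw [e2]
  nth_rewrite 1 [e1]
  exact ⟨add_le_add (mul_le_mul_of_nonneg_left h1.1 ha) (mul_le_mul_of_nonneg_left h2.1 hb),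
    add_le_add (mul_le_mul_of_nonneg_left h1.2 ha) (mul_le_mul_of_nonneg_left h2.2 hb)⟩

theorem Cube.volume_toSet (Q : Cube n) : volume Q.toSet = ENNReal.ofReal Q.side ^ n := by
  rw [Q.toSet_eq_preimage, (PiLp.volume_preserving_ofLp (Fin n)).measure_preimage
    (MeasurableSet.univ_pi fun _ => measurableSet_Icc).nullMeasurableSet, volume_pi_pi]
  simp

theorem Cube.finPos (Q : Cube n) : FinPos Q.toSet := by
  refine ⟨?_, ?_⟩ <;> rw [Q.volume_toSet]
  · exact pow_ne_zero _ (by simpa using Q.side_pos)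
  · exact ENNReal.pow_ne_top ENNReal.ofReal_ne_top

theorem Cube.volume_frontier (Q : Cube n) : volume (frontier Q.toSet) = 0 :=
  Q.convex.addHaar_frontier _

theorem Cube.volume_le_mul {P Q : Cube n} {c : ℝ} (hc : 0 ≤ c) (h : Q.side ≤ c * P.side) :
    volume Q.toSet ≤ ENNReal.ofReal (c ^ n) * volume P.toSet := by
  rw [P.volume_toSet, Q.volume_toSet, ENNReal.ofReal_pow hc, ← mul_pow, ← ENNReal.ofReal_mul hc]
  gcongr

theorem Cube.mem_interior {Q : Cube n} {x : EuclideanSpace ℝ (Fin n)}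
    (h : ∀ i, Q.corner i < x i ∧ x i < Q.corner i + Q.side) : x ∈ interior Q.toSet := by
  rw [_root_.mem_interior]
  refine ⟨WithLp.ofLp ⁻¹' (univ.pi fun i => Ioo (Q.corner i) (Q.corner i + Q.side)), ?_, ?_, ?_⟩
  · intro y hy i
    have := hy i (mem_univ i)
    exact ⟨this.1.le, this.2.le⟩
  · exact (isOpen_set_pi finite_univ fun _ _ => isOpen_Ioo).preimage (PiLp.continuous_ofLp 2 _)
  · intro i _
    exact h i

theorem Cube.margin_le_dist {Q : Cube n} {x y : EuclideanSpace ℝ (Fin n)} {m : ℝ}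
    (h : ∀ i, Q.corner i + m ≤ x i ∧ x i + m ≤ Q.corner i + Q.side) (hy : y ∉ interior Q.toSet) :
    m ≤ dist x y := by
  by_contra! hlt
  refine hy (Cube.mem_interior fun i => ?_)
  have h1 := (abs_le.1 (abs_sub_le_dist x y i))
  have h2 := h i
  constructor <;> linarith [h1.1, h1.2, h2.1, h2.2]

/-- The cube with centre `p` and sidelength `2 h`. -/
def cubeAt (p : EuclideanSpace ℝ (Fin n)) {h : ℝ} (hh : 0 < h) : Cube n where
  corner := WithLp.toLp 2 fun i => p i - h
  side := 2 * h
  side_pos := by positivity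

@[simp]
theorem cubeAt_side (p : EuclideanSpace ℝ (Fin n)) {h : ℝ} (hh : 0 < h) :
    (cubeAt p hh).side = 2 * h := rfl

@[simp]
theorem cubeAt_corner (p : EuclideanSpace ℝ (Fin n)) {h : ℝ} (hh : 0 < h) (i : Fin n) :
    (cubeAt p hh).corner i = p i - h := rfl

theorem mem_cubeAt {p x : EuclideanSpace ℝ (Fin n)} {h : ℝ} {hh : 0 < h} :
    x ∈ (cubeAt p hh).toSet ↔ ∀ i, |x i - p i| ≤ h := by
  simp only [Cube.toSet, mem_ofPred_eq, cubeAt_corner, cubeAt_side, abs_le]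
  refine forall_congr' fun i => ?_
  constructor <;> rintro ⟨h1, h2⟩ <;> constructor <;> linarith

/-- The centre of a cube. -/
def Cube.center (Q : Cube n) : EuclideanSpace ℝ (Fin n) :=
  WithLp.toLp 2 fun i => Q.corner i + Q.side / 2

@[simp]
theorem Cube.center_apply (Q : Cube n) (i : Fin n) : Q.center i = Q.corner i + Q.side / 2 := rfl

theorem Cube.center_mem (Q : Cube n) : Q.center ∈ Q.toSet := fun i => by
  have := Q.side_pos
  rw [Q.center_apply]
  constructor <;> linarith

theorem Cube.center_margin (Q : Cube n) {y : EuclideanSpace ℝ (Fin n)}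
    (hy : y ∉ interior Q.toSet) : Q.side / 2 ≤ dist Q.center y :=
  Cube.margin_le_dist (fun i => by rw [Q.center_apply]; constructor <;> linarith) hy

/-- The cubes of the subdivision of a cube into `N ^ n` congruent cubes. -/
def Cube.grid (Q : Cube n) {N : ℕ} (hN : 0 < N) (k : Fin n → Fin N) : Cube n where
  corner := WithLp.toLp 2 fun i => Q.corner i + Q.side / N * (k i : ℕ)
  side := Q.side / N
  side_pos := div_pos Q.side_pos (by exact_mod_cast hN)

@[simp]
theorem Cube.grid_side (Q : Cube n) {N : ℕ} (hN : 0 < N) (k : Fin n → Fin N) :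
    (Q.grid hN k).side = Q.side / N := rfl

@[simp]
theorem Cube.grid_corner (Q : Cube n) {N : ℕ} (hN : 0 < N) (k : Fin n → Fin N) (i : Fin n) :
    (Q.grid hN k).corner i = Q.corner i + Q.side / N * (k i : ℕ) := rfl

theorem Cube.grid_subset (Q : Cube n) {N : ℕ} (hN : 0 < N) (k : Fin n → Fin N) :
    (Q.grid hN k).toSet ⊆ Q.toSet := by
  intro x hx i
  have h := hx i
  have hN' : (0 : ℝ) < N := by exact_mod_cast hN
  have hs := div_pos Q.side_pos hN'
  have hk : ((k i : ℕ) : ℝ) + 1 ≤ N := by exact_mod_cast (k i).2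
  have hk0 : (0 : ℝ) ≤ ((k i : ℕ) : ℝ) := Nat.cast_nonneg _
  simp only [Cube.grid_side, Cube.grid_corner] at h
  have e : Q.side / N * N = Q.side := by field_simp
  constructor
  · nlinarith [h.1]
  · nlinarith [h.2]

theorem Cube.exists_grid_mem (Q : Cube n) {N : ℕ} (hN : 0 < N) {x : EuclideanSpace ℝ (Fin n)}
    (hx : x ∈ Q.toSet) : ∃ k, x ∈ (Q.grid hN k).toSet := by
  have hN' : (0 : ℝ) < N := by exact_mod_cast hN
  have hs := div_pos Q.side_pos hN'
  have e : Q.side / N * N = Q.side := by field_simp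
  have : ∀ i, ∃ k : Fin N, Q.corner i + Q.side / N * (k : ℕ) ≤ x i ∧
      x i ≤ Q.corner i + Q.side / N * (k : ℕ) + Q.side / N := by
    intro i
    have h := hx i
    set u := (x i - Q.corner i) / (Q.side / N) with hu
    have hu0 : 0 ≤ u := div_nonneg (by linarith) hs.le
    have hxu : x i = Q.corner i + Q.side / N * u := by rw [hu, mul_div_cancel₀ _ hs.ne']; ring
    have huN : u ≤ N := by
      rw [hu, div_le_iff₀ hs]; linarith
    rcases huN.lt_or_eq with hlt | heq
    · refine ⟨⟨⌊u⌋₊, (Nat.floor_lt hu0).2 hlt⟩, ?_, ?_⟩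
      · have := Nat.floor_le hu0
        rw [hxu]
        simpa using mul_le_mul_of_nonneg_left this hs.le
      · have := (Nat.lt_floor_add_one u).le
        have := mul_le_mul_of_nonneg_left this hs.le
        rw [hxu]
        simp only
        linarith
    -- At the right end u = N the floor is not an index of a cell, so the last cell is taken.
    · refine ⟨⟨N - 1, by omega⟩, ?_, ?_⟩
      · rw [hxu, heq]
        simp only [Nat.cast_sub hN]
        nlinarith
      · rw [hxu, heq]
        simp only [Nat.cast_sub hN]
        push_cast
        nlinarith
  choose k hk using this
  exact ⟨k, hk⟩

theorem Cube.subset_iUnion_grid (Q : Cube n) {N : ℕ} (hN : 0 < N) :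
    Q.toSet ⊆ ⋃ k, (Q.grid hN k).toSet := fun _ hx => by
  simpa using Q.exists_grid_mem hN hx

theorem Cube.volume_grid (Q : Cube n) {N : ℕ} (hN : 0 < N) (k : Fin n → Fin N) :
    volume Q.toSet = Fintype.card (Fin n → Fin N) * volume (Q.grid hN k).toSet := by
  have hN' : (0 : ℝ) < N := by exact_mod_cast hN
  rw [Q.volume_toSet, Cube.volume_toSet, Cube.grid_side, Fintype.card_fun, Fintype.card_fin,
    Fintype.card_fin, Nat.cast_pow, ← mul_pow, ← ENNReal.ofReal_natCast,
    ← ENNReal.ofReal_mul hN'.le]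
  congr 2
  field_simp

end CubeGeometry

/-! ### The absorption argument. -/

section SelfImprovement

/-- Cancelling (M - 1)σ is legitimate only because σ is finite. -/
theorem sub_mul_le_of_sum {M σ K : ℝ≥0∞} (hσ : σ ≠ ⊤) (hM : 1 ≤ M) (hMt : M ≠ ⊤)
    (h : M * σ ≤ (M - 1) * σ + M * K) : σ ≤ M * K := by
  have h2 : (M - 1) * σ ≠ ⊤ := ENNReal.mul_ne_top (ENNReal.sub_ne_top hMt) hσ
  have h3 : M * σ = (M - 1) * σ + σ := by
    nth_rewrite 3 [← one_mul σ]
    rw [← add_mul, tsub_add_cancel_of_le hM]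
  rw [h3] at h
  exact (ENNReal.add_le_add_iff_left h2).1 h

/-- A bounded functional on cubes that, up to a constant, is dominated by its averages over
subdivisions, at least one term of which is under control, is controlled. -/
theorem self_improvement {N : ℕ} (hN : 0 < N) {𝒬 : Set (Cube n)} {F : Cube n → ℝ≥0∞}
    {B K : ℝ≥0∞} (hB : B ≠ ⊤) (hFB : ∀ Q ∈ 𝒬, F Q ≤ B)
    (h : ∀ Q ∈ 𝒬, ∃ G : (Fin n → Fin N) → ℝ≥0∞,
      Fintype.card (Fin n → Fin N) * F Q ≤ ∑ k, G k ∧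
      (∀ k, G k ≤ K ∨ Q.grid hN k ∈ 𝒬 ∧ G k ≤ F (Q.grid hN k) + K) ∧ ∃ k, G k ≤ K) :
    ∀ Q ∈ 𝒬, F Q ≤ (Fintype.card (Fin n → Fin N) : ℝ≥0∞) * K := by
  set σ := ⨆ Q ∈ 𝒬, F Q with hσ
  have hσt : σ ≠ ⊤ := ne_top_of_le_ne_top hB (iSup₂_le hFB)
  have hle : ∀ Q ∈ 𝒬, F Q ≤ σ := fun Q hQ => le_iSup₂_of_le Q hQ le_rfl
  have : Nonempty (Fin n → Fin N) := ⟨fun _ => ⟨0, hN⟩⟩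
  set M : ℝ≥0∞ := (Fintype.card (Fin n → Fin N) : ℝ≥0∞) with hM
  have hM1 : 1 ≤ M := by
    rw [hM]
    exact_mod_cast Fintype.card_pos
  have hMt : M ≠ ⊤ := ENNReal.natCast_ne_top _
  -- Of the M terms one is at most K and each of the others at most σ + K.
  have key : ∀ Q ∈ 𝒬, M * F Q ≤ (M - 1) * σ + M * K := by
    intro Q hQ
    obtain ⟨G, hG, hGk, k₀, hk₀⟩ := h Q hQ
    refine hG.trans ?_
    rw [← Finset.add_sum_erase _ _ (Finset.mem_univ k₀)]
    have h1 : ∀ k ∈ Finset.univ.erase k₀, G k ≤ σ + K := by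
      intro k _
      rcases hGk k with h1 | ⟨h1, h2⟩
      · exact h1.trans le_add_self
      · exact h2.trans (by gcongr; exact hle _ h1)
    have h2 := Finset.sum_le_card_nsmul _ _ _ h1
    rw [Finset.card_erase_of_mem (Finset.mem_univ k₀), Finset.card_univ, nsmul_eq_mul] at h2
    have h3 : ((Fintype.card (Fin n → Fin N) - 1 : ℕ) : ℝ≥0∞) = M - 1 := by
      rw [hM, ENNReal.natCast_sub, Nat.cast_one]
    rw [h3] at h2
    calc _ ≤ K + (M - 1) * (σ + K) := add_le_add hk₀ h2
      _ = (M - 1) * σ + ((M - 1) + 1) * K := by ring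
      _ = _ := by rw [tsub_add_cancel_of_le hM1]
  have hMσ : M * σ ≤ (M - 1) * σ + M * K := by
    conv_lhs => rw [hσ]
    simp_rw [ENNReal.mul_iSup]
    exact iSup₂_le key
  exact fun Q hQ => (hle Q hQ).trans (sub_mul_le_of_sum hσt hM1 hMt hMσ)

end SelfImprovement

/-! ### From cubes well inside R to R itself. -/

section CubeOscillation

/-- The translation is made in M steps of at most h per coordinate. Two consecutive cubes both
contain the cube of half the size at the midpoint of their centres, which has 2^(-n) of their
volume. -/
theorem meanDiff_cubeAt_translate_le {f : EuclideanSpace ℝ (Fin n) → ℝ} (hf : Measurable f)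
    {h : ℝ} (hh : 0 < h) {p q : EuclideanSpace ℝ (Fin n)} {M : ℕ} (hM : 0 < M) {W : ℝ≥0∞}
    (hpq : ∀ i, |q i - p i| ≤ M * h)
    (hW : ∀ s ∈ Icc (0 : ℝ) 1, meanDiff f (cubeAt (p + s • (q - p)) hh).toSet
      (cubeAt (p + s • (q - p)) hh).toSet ≤ W) :
    meanDiff f (cubeAt p hh).toSet (cubeAt q hh).toSet ≤ (1 + M * (2 ^ n * 2)) * W := by
  have hM' : (0 : ℝ) < M := by exact_mod_cast hM
  set c : ℕ → Cube n := fun j => cubeAt (p + ((j : ℝ) / M) • (q - p)) hh with hc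
  have hmem : ∀ j ≤ M, ((j : ℝ) / M) ∈ Icc (0 : ℝ) 1 := fun j hj =>
    ⟨by positivity, div_le_one_of_le₀ (by exact_mod_cast hj) hM'.le⟩
  have hstep : ∀ j < M, meanDiff f (c j).toSet (c (j + 1)).toSet ≤ 2 ^ n * 2 * W := by
    intro j hj
    have hh2 : 0 < h / 2 := half_pos hh
    set I := cubeAt (p + (((j : ℝ) + 1 / 2) / M) • (q - p)) hh2 with hI
    have hIj : I.toSet ⊆ (c j).toSet := by
      intro x hx
      rw [hI, mem_cubeAt] at hx
      rw [hc, mem_cubeAt]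
      intro i
      have h1 := abs_le.1 (hx i)
      have h2 := abs_le.1 (hpq i)
      simp only [PiLp.add_apply, PiLp.smul_apply, PiLp.sub_apply, smul_eq_mul] at h1 ⊢
      have e : ((j : ℝ) + 1 / 2) / M * (q i - p i) = (j : ℝ) / M * (q i - p i)
        + (q i - p i) / M / 2 := by field_simp
      have h3 : (q i - p i) / M ≤ h := by rw [div_le_iff₀ hM']; linarith
      have h4 : -h ≤ (q i - p i) / M := by rw [le_div_iff₀ hM']; linarith
      rw [abs_le]
      constructor <;> linarith
    have hIj' : I.toSet ⊆ (c (j + 1)).toSet := by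
      intro x hx
      rw [hI, mem_cubeAt] at hx
      rw [hc, mem_cubeAt]
      intro i
      have h1 := abs_le.1 (hx i)
      have h2 := abs_le.1 (hpq i)
      simp only [PiLp.add_apply, PiLp.smul_apply, PiLp.sub_apply, smul_eq_mul] at h1 ⊢
      push_cast
      have e : ((j : ℝ) + 1 / 2) / M * (q i - p i) = ((j : ℝ) + 1) / M * (q i - p i)
        - (q i - p i) / M / 2 := by field_simp; ring
      have h3 : (q i - p i) / M ≤ h := by rw [div_le_iff₀ hM']; linarith
      have h4 : -h ≤ (q i - p i) / M := by rw [le_div_iff₀ hM']; linarith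
      rw [abs_le]
      constructor <;> linarith
    have hv : ∀ j, volume (c j).toSet ≤ 2 ^ n * volume I.toSet := by
      intro j
      have := Cube.volume_le_mul (P := I) (Q := c j) (c := 2) (by norm_num)
        (by simp only [hc, hI, cubeAt_side]; linarith)
      simpa [ENNReal.ofReal_pow] using this
    refine (meanDiff_le_of_common hf hIj hIj' (c j).finPos (c (j + 1)).finPos I.finPos
      (hv j) (hv _)).trans ?_
    calc _ ≤ 2 ^ n * (W + W) := by
          gcongr
          · exact hW _ (hmem j hj.le)
          · exact hW _ (hmem (j + 1) hj)
      _ = _ := by ring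
  have hind : ∀ j ≤ M, meanDiff f (c 0).toSet (c j).toSet ≤ (1 + j * (2 ^ n * 2)) * W := by
    intro j
    induction j with
    | zero =>
      intro _
      simpa [hc] using hW _ (hmem 0 (Nat.zero_le _))
    | succ j ih =>
      intro hj
      refine (meanDiff_triangle hf (c 0).finPos (c j).finPos (c (j + 1)).finPos).trans ?_
      refine (add_le_add (ih (by omega)) (hstep j (by omega))).trans (le_of_eq ?_)
      push_cast
      ring
  have h0 : c 0 = cubeAt p hh := by simp [hc]
  have hMM : c M = cubeAt q hh := by simp [hc, hM'.ne']
  have := hind M le_rfl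
  rwa [h0, hMM] at this

/-- The mean oscillation over any cube is controlled by the mean oscillations over the cubes well
inside of it. -/
theorem exists_meanDiff_cube_le (n : ℕ) (hn : 1 ≤ n) : ∃ C : ℝ≥0, 1 ≤ C ∧
    ∀ (f : EuclideanSpace ℝ (Fin n) → ℝ), Measurable f → ∀ (R : Cube n) (W : ℝ≥0∞),
      (∀ P : Cube n, P.toSet ⊆ R.toSet → P.side ≤ R.side →
        (∀ x ∈ P.toSet, ∀ y ∉ interior R.toSet, Metric.diam P.toSet ≤ dist x y) →
        meanDiff f P.toSet P.toSet ≤ W) →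
      meanDiff f R.toSet R.toSet ≤ C * W := by
  -- N is odd, so the central cube is itself a cell. With half side h = ℓ/(2N) one has h + 2√n h ≤
  -- (2n + 1)h = ℓ/2, so that cell is farther from the boundary than its diameter bound 2√n h.
  set N : ℕ := 2 * n + 1 with hNdef
  have hN : 0 < N := by omega
  have hN' : (0 : ℝ) < N := by exact_mod_cast hN
  have hNr : (N : ℝ) = 2 * n + 1 := by rw [hNdef]; push_cast; ring
  have hn' : (1 : ℝ) ≤ n := by exact_mod_cast hn
  have hsq : √(n : ℝ) ≤ n := by
    rw [Real.sqrt_le_left (by linarith)]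
    nlinarith
  -- N² translation steps carry the centre of P to the centre of a cell, by cubes as small as the
  -- central cell of that cell; N^n is the volume ratio to the central cell of P.
  set K₀ : ℝ≥0 := 1 + (N ^ 2 : ℕ) * (2 ^ n * 2) + N ^ n with hK₀
  set m : ℝ≥0 := (Fintype.card (Fin n → Fin N) : ℝ≥0) with hm
  have hm1 : 1 ≤ m := by
    have : Nonempty (Fin n → Fin N) := ⟨fun _ => ⟨0, hN⟩⟩
    rw [hm]
    exact_mod_cast Fintype.card_pos
  have hK1 : 1 ≤ K₀ := by
    rw [hK₀, add_assoc]
    exact le_self_add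
  refine ⟨2 * (m * K₀), ?_, ?_⟩
  · calc (1 : ℝ≥0) ≤ m * K₀ := one_le_mul hm1 hK1
      _ ≤ 2 * (m * K₀) := by rw [two_mul]; exact le_self_add
  intro f hf R W hW
  refine meanDiff_le_of_truncate_le hf R.finPos R.finPos fun k => ?_
  set g := truncate k f with hg
  have hgm : Measurable g := measurable_truncate k hf
  set 𝒬 : Set (Cube n) := {P | P.toSet ⊆ R.toSet ∧ P.side ≤ R.side} with h𝒬
  have hinner : ∀ P ∈ 𝒬, ∀ (x : EuclideanSpace ℝ (Fin n)) (h : ℝ) (hh : 0 < h),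
      (∀ i, |x i - P.center i| + h + √n * (2 * h) ≤ P.side / 2) →
      meanDiff g (cubeAt x hh).toSet (cubeAt x hh).toSet ≤ W := by
    intro P hP x h hh hx
    have hsh : 0 ≤ √(n : ℝ) * (2 * h) := by positivity
    have hmar : ∀ y ∈ (cubeAt x hh).toSet, ∀ i, P.corner i + √n * (2 * h) ≤ y i ∧
        y i + √n * (2 * h) ≤ P.corner i + P.side := by
      intro y hy i
      have h1 := abs_le.1 (mem_cubeAt.1 hy i)
      have h2 := hx i
      have h3 := abs_le.1 (show |x i - P.center i| ≤ P.side / 2 - h - √n * (2 * h) by linarith)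
      rw [P.center_apply] at h3
      constructor <;> linarith
    refine (meanDiff_truncate_le _ _ _ _).trans (hW _ ?_ ?_ ?_)
    · refine Subset.trans (b := P.toSet) (fun y hy i => ?_) hP.1
      have := hmar y hy i
      constructor <;> linarith
    · refine le_trans ?_ hP.2
      have := hx ⟨0, hn⟩
      have h0 := abs_nonneg (x ⟨0, hn⟩ - P.center ⟨0, hn⟩)
      rw [cubeAt_side]
      linarith
    · intro y hy z hz
      refine (Cube.diam_le _).trans (Cube.margin_le_dist (Q := P) (hmar y hy) fun hz' => hz ?_)
      exact interior_mono hP.1 hz'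
  have hpos : ∀ P : Cube n, 0 < P.side / (2 * N) := fun P =>
    div_pos P.side_pos (by positivity)
  set c : Cube n → Cube n := fun P => cubeAt P.center (hpos P) with hc
  have hcP : ∀ P ∈ 𝒬, meanDiff g (c P).toSet (c P).toSet ≤ W := by
    intro P hP
    refine hinner P hP _ _ _ fun i => ?_
    have := P.side_pos
    rw [sub_self, abs_zero, zero_add]
    have e : P.side = P.side / (2 * N) * (2 * (2 * n + 1)) := by rw [← hNr]; field_simp
    have := mul_le_mul_of_nonneg_right hsq (hpos P).le
    linarith
  have hgrid : ∀ P ∈ 𝒬, ∀ k : Fin n → Fin N, P.grid hN k ∈ 𝒬 := by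
    intro P hP k
    refine ⟨(P.grid_subset hN k).trans hP.1, le_trans ?_ hP.2⟩
    exact div_le_self P.side_pos.le (by exact_mod_cast hN)
  have hlink : ∀ P ∈ 𝒬, ∀ k : Fin n → Fin N,
      meanDiff g (c (P.grid hN k)).toSet (c P).toSet ≤ K₀ * W := by
    intro P hP k
    set h := P.side / N / (2 * N) with hh
    have hh0 : 0 < h := hpos (P.grid hN k)
    have eh : P.side = h * (2 * N ^ 2) := by rw [hh]; field_simp
    have hp : ∀ i, |(P.grid hN k).center i - P.center i| ≤ P.side / 2 - P.side / N / 2 := by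
      intro i
      have hk : ((k i : ℕ) : ℝ) + 1 ≤ N := by exact_mod_cast (k i).2
      have hk0 : (0 : ℝ) ≤ ((k i : ℕ) : ℝ) := Nat.cast_nonneg _
      have hs := div_pos P.side_pos hN'
      have e : P.side / N * N = P.side := by field_simp
      have h1 := mul_le_mul_of_nonneg_left hk hs.le
      have h2 := mul_nonneg hs.le hk0
      simp only [Cube.center_apply, Cube.grid_corner, Cube.grid_side]
      rw [abs_le]
      constructor <;> linarith
    have e2 : P.side / N = h * (2 * N) := by rw [eh]; field_simp
    have h1 : meanDiff g (cubeAt P.center hh0).toSet (cubeAt (P.grid hN k).center hh0).toSet ≤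
        (1 + (N ^ 2 : ℕ) * (2 ^ n * 2)) * W := by
      refine meanDiff_cubeAt_translate_le hgm hh0 (by positivity) (fun i => ?_) fun s hs => ?_
      · refine (hp i).trans ?_
        rw [e2, eh]
        push_cast
        have : 0 ≤ h * N := by positivity
        linarith
      · refine hinner P hP _ _ _ fun i => ?_
        simp only [PiLp.add_apply, PiLp.smul_apply, PiLp.sub_apply, smul_eq_mul,
          add_sub_cancel_left, abs_mul, abs_of_nonneg hs.1]
        have h3 : s * |(P.grid hN k).center i - P.center i| ≤ P.side / 2 - P.side / N / 2 :=
          (mul_le_of_le_one_left (abs_nonneg _) hs.2).trans (hp i)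
        have h4 := mul_le_mul_of_nonneg_right hsq hh0.le
        rw [e2, hNr] at h3
        linarith
    have h2 : meanDiff g (cubeAt P.center hh0).toSet (c P).toSet ≤ (N : ℝ≥0∞) ^ n * W := by
      have hsub : (cubeAt P.center hh0).toSet ⊆ (c P).toSet := by
        intro y hy
        rw [hc, mem_cubeAt]
        intro i
        refine (mem_cubeAt.1 hy i).trans ?_
        rw [hh]
        gcongr
        exact div_le_self P.side_pos.le (by exact_mod_cast hN)
      refine (meanDiff_mono_left _ hsub (Cube.finPos _) (Cube.finPos _)
        (c := (N : ℝ≥0∞) ^ n) ?_).trans (by gcongr; exact hcP P hP)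
      refine (Cube.volume_le_mul (P := cubeAt P.center hh0) (Q := c P) (c := N) hN'.le ?_).trans (le_of_eq ?_)
      · simp only [hc, cubeAt_side, hh]
        apply le_of_eq
        field_simp
      · rw [ENNReal.ofReal_pow hN'.le, ENNReal.ofReal_natCast]
    rw [meanDiff_comm hgm] at h1
    refine (meanDiff_triangle hgm (Cube.finPos _) (cubeAt P.center hh0).finPos
      (Cube.finPos _)).trans ((add_le_add h1 h2).trans (le_of_eq ?_))
    rw [hK₀]
    push_cast
    ring
  -- The controlled term of the subdivision is the central cell, which equals c P.
  have hSI := self_improvement (n := n) hN (𝒬 := 𝒬) (F := fun P => meanDiff g P.toSet (c P).toSet)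
    (B := ENNReal.ofReal (2 * k)) (K := K₀ * W) ENNReal.ofReal_ne_top
    (fun P _ => meanDiff_le_of_abs_le (abs_truncate_le k f) _ _) ?_ R ⟨subset_rfl, le_rfl⟩
  · refine (meanDiff_self_le hgm R.finPos (c R).finPos).trans ?_
    calc _ ≤ 2 * ((Fintype.card (Fin n → Fin N) : ℝ≥0∞) * (K₀ * W)) := by gcongr
      _ = _ := by rw [hm]; push_cast; ring
  · intro P hP
    refine ⟨fun k => meanDiff g (P.grid hN k).toSet (c P).toSet,
      card_mul_meanDiff_le_sum _ P.finPos (P.subset_iUnion_grid hN) (P.volume_grid hN),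
      fun k => Or.inr ⟨hgrid P hP k, ?_⟩, fun _ => ⟨n, by omega⟩, ?_⟩
    · exact (meanDiff_triangle hgm (Cube.finPos _) (c (P.grid hN k)).finPos
        (Cube.finPos _)).trans (add_le_add le_rfl (hlink P hP k))
    · have e : P.grid hN (fun _ => ⟨n, by omega⟩) = c P := by
        ext i
        · simp only [hc, Cube.grid_corner, cubeAt_corner, Cube.center_apply]
          field_simp
          rw [hNr]
          ring
        · simp only [hc, Cube.grid_side, cubeAt_side]
          field_simp
      simp only [e]
      refine (hcP P hP).trans ?_
      nth_rewrite 1 [← one_mul W]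
      gcongr
      exact_mod_cast hK1

end CubeOscillation

/-! ### Whitney chains under the Jones condition. -/

section Whitney

theorem setDist_le_dist {A B : Set (EuclideanSpace ℝ (Fin n))} {x y : EuclideanSpace ℝ (Fin n)}
    (hx : x ∈ A) (hy : y ∈ B) : setDist A B ≤ dist x y := by
  refine csInf_le ⟨0, ?_⟩ (mem_image2_of_mem hx hy)
  rintro _ ⟨a, _, b, _, rfl⟩
  exact dist_nonneg

theorem setDist_nonneg (A B : Set (EuclideanSpace ℝ (Fin n))) : 0 ≤ setDist A B := by
  refine Real.sInf_nonneg ?_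
  rintro _ ⟨a, _, b, _, rfl⟩
  exact dist_nonneg

theorem exists_dist_lt_of_setDist_lt {A B : Set (EuclideanSpace ℝ (Fin n))} (hA : A.Nonempty)
    (hB : B.Nonempty) {r : ℝ} (h : setDist A B < r) : ∃ x ∈ A, ∃ y ∈ B, dist x y < r := by
  obtain ⟨_, ⟨x, hx, y, hy, rfl⟩, hr⟩ := exists_lt_of_csInf_lt (hA.image2 hB) h
  exact ⟨x, hx, y, hy, hr⟩

variable {O : Set (EuclideanSpace ℝ (Fin n))} {E : Set (Cube n)}

theorem IsWhitney.subset (hE : IsWhitney O E) {S : Cube n} (hS : S ∈ E) : S.toSet ⊆ O := by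
  rw [← hE.union_eq]
  exact subset_biUnion_of_mem (u := Cube.toSet) hS

theorem IsWhitney.exists_mem (hE : IsWhitney O E) {x : EuclideanSpace ℝ (Fin n)} (hx : x ∈ O) :
    ∃ S ∈ E, x ∈ S.toSet := by
  rw [← hE.union_eq] at hx
  simpa using hx

theorem IsWhitney.side_le (hE : IsWhitney O E) {S : Cube n} (hS : S ∈ E)
    {x y : EuclideanSpace ℝ (Fin n)} (hx : x ∈ S.toSet) (hy : y ∉ O) : S.side ≤ dist x y :=
  (hE.side_le_dist S hS).trans (setDist_le_dist hx hy)

theorem IsWhitney.exists_dist_le (hn : 1 ≤ n) (hE : IsWhitney O E) (hO : Oᶜ.Nonempty) {S : Cube n}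
    (hS : S ∈ E) : ∃ y ∉ O, ∀ x ∈ S.toSet, dist x y ≤ 6 * √n * S.side := by
  have hn' : (0 : ℝ) < √n := Real.sqrt_pos.2 (by exact_mod_cast hn)
  have hs := mul_pos hn' S.side_pos
  obtain ⟨a, ha, y, hy, hay⟩ := exists_dist_lt_of_setDist_lt ⟨_, S.corner_mem⟩ hO
    (show setDist S.toSet Oᶜ < 5 * (√n * S.side) by
      have := hE.dist_le_side S hS
      linarith)
  refine ⟨y, hy, fun x hx => ?_⟩
  have := Cube.dist_le hx ha
  have := dist_triangle x a y
  linarith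

theorem IsWhitneyChain.dist_le {Q R : Cube n} {m : ℕ} {c : ℕ → Cube n}
    (hc : IsWhitneyChain E Q R m c) {a b : ℕ} (hab : a ≤ b) (hb : b ≤ m)
    {x y : EuclideanSpace ℝ (Fin n)} (hx : x ∈ (c a).toSet) (hy : y ∈ (c b).toSet) :
    dist x y ≤ √n * ∑ j ∈ Finset.Ico a (b + 1), (c j).side := by
  induction b, hab using Nat.le_induction generalizing y with
  | base => simpa using Cube.dist_le hx hy
  | succ b hab ih =>
    obtain ⟨z, hz, hz'⟩ := (hc.2.2.2 b (by omega)).2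
    rw [Finset.sum_Ico_succ_top (by omega), mul_add]
    exact (dist_triangle x z y).trans (add_le_add (ih (by omega) hz) (Cube.dist_le hz' hy))

theorem IsWhitneyChain.append {Q R T : Cube n} {k m : ℕ} {c d : ℕ → Cube n}
    (hc : IsWhitneyChain E Q R k c) (hd : IsWhitneyChain E R T m d) :
    ∃ e, IsWhitneyChain E Q T (k + m) e := by
  refine ⟨fun j => if j ≤ k then c j else d (j - k), ?_, ?_, ?_, ?_⟩
  · simp [hc.1]
  · by_cases hm : m = 0
    · subst hm
      simp only [add_zero, le_refl, if_true]
      rw [hc.2.1, ← hd.1, hd.2.1]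
    · simp only [show ¬ k + m ≤ k by omega, if_false, Nat.add_sub_cancel_left]
      exact hd.2.1
  · intro i hi
    beta_reduce
    split_ifs with h
    · exact hc.2.2.1 i h
    · exact hd.2.2.1 _ (by omega)
  · intro i hi
    by_cases h1 : i + 1 ≤ k
    · simp only [h1, if_true, show i ≤ k by omega]
      exact hc.2.2.2 i h1
    · by_cases h2 : i ≤ k
      · have hik : i = k := by omega
        subst hik
        simp only [le_refl, if_true, h1, if_false, Nat.add_sub_cancel_left]
        rw [hc.2.1, ← hd.1]
        exact hd.2.2.2 0 (by omega)
      · simp only [h1, h2, if_false]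
        rw [show i + 1 - k = i - k + 1 by omega]
        exact hd.2.2.2 _ (by omega)

theorem IsWhitneyChain.slice {Q R : Cube n} {m : ℕ} {c : ℕ → Cube n}
    (hc : IsWhitneyChain E Q R m c) {i j : ℕ} (hij : i ≤ j) (hj : j ≤ m) :
    IsWhitneyChain E (c i) (c j) (j - i) fun l => c (i + l) :=
  ⟨rfl, by simp only [Nat.add_sub_cancel' hij], fun l hl => hc.2.2.1 _ (by omega),
    fun l hl => hc.2.2.2 _ (by omega)⟩

theorem d₂_nonneg (Q R : Cube n) : 0 ≤ d₂ Q R := by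
  have h : 0 ≤ setDist Q.toSet R.toSet / (Q.side + R.side) :=
    div_nonneg (setDist_nonneg _ _) (add_pos Q.side_pos R.side_pos).le
  exact add_nonneg (abs_nonneg _) (Real.logb_nonneg (by norm_num) (by linarith))

theorem d₂_le {Q R : Cube n} {A D : ℝ} (hQ : Q.side ≤ A * R.side)
    (hR : R.side ≤ A * Q.side) {x y : EuclideanSpace ℝ (Fin n)} (hx : x ∈ Q.toSet)
    (hy : y ∈ R.toSet) (hD : dist x y ≤ D * (Q.side + R.side)) :
    d₂ Q R ≤ Real.logb 2 A + Real.logb 2 (2 + D) := by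
  have hq := Q.side_pos
  have hr := R.side_pos
  have hA : 0 < A := pos_of_mul_pos_left (hq.trans_le hQ) hr.le
  have h0 : 0 ≤ setDist Q.toSet R.toSet / (Q.side + R.side) :=
    div_nonneg (setDist_nonneg _ _) (add_pos hq hr).le
  refine add_le_add (abs_le.2 ⟨?_, ?_⟩) ?_
  · rw [← Real.logb_inv, Real.logb_le_logb (by norm_num) (by positivity) (by positivity),
      le_div_iff₀ hr, inv_mul_le_iff₀ hA]
    exact hR
  · rw [Real.logb_le_logb (by norm_num) (by positivity) hA, div_le_iff₀ hr]
    exact hQ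
  · have h1 : setDist Q.toSet R.toSet / (Q.side + R.side) ≤ D := by
      rw [div_le_iff₀ (by positivity)]
      exact (setDist_le_dist hx hy).trans hD
    rw [Real.logb_le_logb (by norm_num) (by linarith) (by linarith)]
    linarith

/-- Shortest chains under the Jones condition. -/
theorem JonesCondition.exists_shortest_chain {κ : ℝ} (hκ : 0 < κ) (hJ : JonesCondition κ E)
    {Q R : Cube n} (hQ : Q ∈ E) (hR : R ∈ E) : ∃ m c, IsWhitneyChain E Q R m c ∧
      ∀ i j, i ≤ j → j ≤ m → ((j - i : ℕ) : ℝ) ≤ κ * d₂ (c i) (c j) := by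
  have key : ∀ Q ∈ E, ∀ R ∈ E, ∃ m, (∃ c, IsWhitneyChain E Q R m c) ∧
      (∀ k, (∃ c, IsWhitneyChain E Q R k c) → m ≤ k) ∧ (m : ℝ) ≤ κ * d₂ Q R := by
    classical
    intro Q hQ R hR
    have hd := hJ Q hQ R hR
    by_cases hex : ∃ m, ∃ c, IsWhitneyChain E Q R m c
    · refine ⟨Nat.find hex, Nat.find_spec hex, fun k hk => Nat.find_min' hex hk, ?_⟩
      have h1 : ((Nat.find hex : ℕ) : ℕ∞) ≤ d₁ E Q R :=
        le_iInf₂ fun k hk => by exact_mod_cast Nat.find_min' hex hk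
      have h2 : ((Nat.find hex : ℕ) : ℝ≥0∞) ≤ ENNReal.ofReal (κ * d₂ Q R) := by
        refine le_trans ?_ hd
        exact_mod_cast h1
      rcases Nat.eq_zero_or_pos (Nat.find hex) with h0 | h0
      · rw [h0, Nat.cast_zero]
        exact mul_nonneg hκ.le (d₂_nonneg _ _)
      · exact (ENNReal.natCast_le_ofReal h0.ne').1 h2
    · exfalso
      push Not at hex
      have h1 : d₁ E Q R = ⊤ := by
        unfold d₁
        simp [hex]
      rw [h1] at hd
      simp at hd
  obtain ⟨m, ⟨c, hc⟩, hmin, -⟩ := key Q hQ R hR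
  refine ⟨m, c, hc, fun i j hij hj => ?_⟩
  obtain ⟨k, ⟨c', hc'⟩, -, hk⟩ := key (c i) (hc.2.2.1 i (by omega)) (c j) (hc.2.2.1 j hj)
  refine le_trans ?_ hk
  have h1 := hc.slice (Nat.zero_le i) (by omega)
  have h2 := hc.slice hj le_rfl
  rw [hc.1] at h1
  rw [hc.2.1] at h2
  -- Replacing the piece from i to j by a chain of length k connects Q and R in i + k + (m - j)
  -- steps; minimality of m forces j - i ≤ k. Hence every piece of a shortest chain obeys the Jones
  -- bound.
  obtain ⟨e, he⟩ := h1.append hc'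
  obtain ⟨e', he'⟩ := he.append h2
  have := hmin _ ⟨e', he'⟩
  have : j - i ≤ k := by omega
  exact_mod_cast this

/-- A logarithm grows slower than a linear function. From log (εy) ≤ εy - 1, with ε chosen to give N
the coefficient 1/2 on the right, N is absorbed. -/
theorem exists_nat_bound_of_le_log {κ a b : ℝ} (hκ : 0 < κ) (ha : 0 < a) :
    ∃ N₀ : ℕ, ∀ N : ℕ, (N : ℝ) ≤ κ * (b + Real.logb 2 (2 + a * (N + 1))) → N ≤ N₀ := by
  have hl : 0 < Real.log 2 := Real.log_pos (by norm_num)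
  set ε : ℝ := Real.log 2 / (2 * κ * a) with hε
  have hε0 : 0 < ε := by positivity
  obtain ⟨N₀, hN₀⟩ := exists_nat_ge (2 * (κ * b + κ / Real.log 2 * (2 * ε + ε * a - 1 - Real.log ε)))
  refine ⟨N₀, fun N hN => ?_⟩
  have hy : 0 < 2 + a * ((N : ℝ) + 1) := by positivity
  have h1 := Real.log_le_sub_one_of_pos (mul_pos hε0 hy)
  rw [Real.log_mul hε0.ne' hy.ne'] at h1
  have h2 : Real.log (2 + a * (N + 1)) ≤ (ε * a) * N + (2 * ε + ε * a - 1 - Real.log ε) := by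
    linarith
  have h3 : κ / Real.log 2 * (ε * a) = 1 / 2 := by rw [hε]; field_simp
  have h4 := mul_le_mul_of_nonneg_left h2 (div_pos hκ hl).le
  rw [mul_add (κ / Real.log 2), ← mul_assoc, h3] at h4
  have h5 : κ * (b + Real.logb 2 (2 + a * (N + 1)))
      = κ * b + κ / Real.log 2 * Real.log (2 + a * (N + 1)) := by
    rw [Real.logb]; field_simp
  rw [h5] at hN
  have : (N : ℝ) ≤ N₀ := by linarith
  exact_mod_cast this

/-- A piece of a shortest chain with large ends is short. -/
theorem IsWhitneyChain.length_le {κ : ℝ} (hκ : 0 < κ) {Q R : Cube n} {m : ℕ} {c : ℕ → Cube n}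
    (hc : IsWhitneyChain E Q R m c)
    (hd : ∀ i j, i ≤ j → j ≤ m → ((j - i : ℕ) : ℝ) ≤ κ * d₂ (c i) (c j))
    {N₀ : ℕ} (hN₀ : ∀ N : ℕ, (N : ℝ) ≤ κ * (3 + Real.logb 2 (2 + 4 * √n * (N + 1))) → N ≤ N₀)
    {i j : ℕ} (hij : i ≤ j) (hj : j ≤ m) {σ : ℝ} (hi : σ ≤ (c i).side)
    (hj' : σ ≤ (c j).side) (hle : ∀ l, i ≤ l → l ≤ j → (c l).side ≤ 8 * σ) : j - i ≤ N₀ := by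
  refine hN₀ _ ((hd i j hij hj).trans ?_)
  have hcast : ((j - i : ℕ) : ℝ) = j - i := Nat.cast_sub hij
  have hsum : ∑ l ∈ Finset.Ico i (j + 1), (c l).side ≤ ((j - i : ℕ) + 1) * (8 * σ) := by
    have := Finset.sum_le_card_nsmul (Finset.Ico i (j + 1)) (fun l => (c l).side) (8 * σ)
      fun l hl => by
        rw [Finset.mem_Ico] at hl
        exact hle l hl.1 (by omega)
    rw [Nat.card_Ico, nsmul_eq_mul, show j + 1 - i = j - i + 1 by omega] at this
    exact_mod_cast this
  have h8 : Real.logb 2 8 = 3 := by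
    rw [show (8 : ℝ) = 2 ^ (3 : ℕ) by norm_num, Real.logb_pow, Real.logb_self_eq_one (by norm_num)]
    norm_num
  have hdist := hc.dist_le hij hj (c i).corner_mem (c j).corner_mem
  have h0 : 0 ≤ √(n : ℝ) := Real.sqrt_nonneg _
  have key : d₂ (c i) (c j) ≤ Real.logb 2 8 + Real.logb 2 (2 + 4 * √n * ((j - i : ℕ) + 1)) := by
    refine d₂_le ?_ ?_ (c i).corner_mem (c j).corner_mem ?_
    · exact (hle i le_rfl hij).trans (by linarith)
    · exact (hle j hij le_rfl).trans (by linarith)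
    · refine hdist.trans ((mul_le_mul_of_nonneg_left hsum h0).trans ?_)
      have h1 : 0 ≤ 4 * √(n : ℝ) * ((j - i : ℕ) + 1) := by positivity
      calc _ = 4 * √(n : ℝ) * ((j - i : ℕ) + 1) * (σ + σ) := by ring
        _ ≤ _ := by gcongr
  rw [h8] at key
  exact mul_le_mul_of_nonneg_left key hκ.le

/-- Shortest chains reach large cubes along geometrically growing ones. -/
theorem IsWhitneyChain.exists_first_large (hE : IsWhitney O E) {κ : ℝ} (hκ : 0 < κ) {Q R : Cube n}
    {m : ℕ} {c : ℕ → Cube n} (hc : IsWhitneyChain E Q R m c)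
    (hd : ∀ i j, i ≤ j → j ≤ m → ((j - i : ℕ) : ℝ) ≤ κ * d₂ (c i) (c j))
    {N₀ : ℕ} (hN₀ : ∀ N : ℕ, (N : ℝ) ≤ κ * (3 + Real.logb 2 (2 + 4 * √n * (N + 1))) → N ≤ N₀)
    (k : ℕ) : ∀ τ : ℝ, 0 < τ → (1 / 2) ^ k * τ ≤ (c 0).side → τ ≤ (c m).side →
      ∃ i ≤ m, τ ≤ (c i).side ∧ (∀ j < i, (c j).side < τ) ∧
        ∑ j ∈ Finset.range i, (c j).side ≤ 2 * N₀ * τ := by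
  classical
  induction k with
  | zero =>
    intro τ hτ h0 _
    exact ⟨0, Nat.zero_le _, by simpa using h0, by simp, by simp; positivity⟩
  | succ k ih =>
    intro τ hτ h0 hm
    have hex : ∃ i, i ≤ m ∧ τ ≤ (c i).side := ⟨m, le_rfl, hm⟩
    -- Up to the first cube of side at least τ/2 the sides sum to at most N₀τ; from there to the
    -- first of side at least τ there are at most N₀ more, each shorter than τ. The sum is again at
    -- most 2N₀τ.
    obtain ⟨i', hi'm, hi', hlt', hsum'⟩ := ih (τ / 2) (half_pos hτ)
      (by rw [pow_succ] at h0; linarith) (by linarith)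
    set i := Nat.find hex with hi
    obtain ⟨him, hiτ⟩ : i ≤ m ∧ τ ≤ (c i).side := Nat.find_spec hex
    have hlt : ∀ j < i, (c j).side < τ := by
      intro j hj
      by_contra! hcon
      exact Nat.find_min hex hj ⟨by omega, hcon⟩
    have hii : i' ≤ i := by
      by_contra! hcon
      have := hlt' i hcon
      linarith
    have hlen : i - i' ≤ N₀ := by
      rcases hii.lt_or_eq with hlt2 | heq
      swap
      · omega
      refine hc.length_le hκ hd hN₀ hii him (σ := τ / 2) hi' (by linarith) fun l hl hl' => ?_
      rcases hl'.lt_or_eq with h1 | h1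
      · have := hlt l h1
        linarith
      · rw [h1] at hl ⊢
        clear h1 hl' l
        -- The last cube is at most four times its predecessor, hence below 4τ = 8(τ/2): the factor
        -- 8 in `length_le`.
        have h2 := hlt (i - 1) (by omega)
        have h3 := hc.2.2.2 (i - 1) (by omega)
        rw [show i - 1 + 1 = i by omega] at h3
        have := (hE.adjacent_le _ (hc.2.2.1 _ (by omega)) _ (hc.2.2.1 _ him) h3).2
        linarith
    refine ⟨i, him, hiτ, hlt, ?_⟩
    rw [← Finset.sum_range_add_sum_Ico _ hii]
    have h1 := Finset.sum_le_card_nsmul (Finset.Ico i' i) (fun l => (c l).side) τ fun l hl => by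
      rw [Finset.mem_Ico] at hl
      exact (hlt l hl.2).le
    rw [Nat.card_Ico, nsmul_eq_mul] at h1
    have h2 : ((i - i' : ℕ) : ℝ) * τ ≤ N₀ * τ := by
      gcongr
    linarith

/-- Every cube is close to a cube of any given larger size that occurs at all. -/
theorem exists_near_large_cube (n : ℕ) (hn : 1 ≤ n) {κ : ℝ} (hκ : 0 < κ) : ∃ A : ℝ, 1 ≤ A ∧
    ∀ (O : Set (EuclideanSpace ℝ (Fin n))) (E : Set (Cube n)), IsWhitney O E →
      JonesCondition κ E → ∀ S ∈ E, ∀ R ∈ E, ∀ τ : ℝ, S.side ≤ τ → τ ≤ R.side →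
      ∃ T ∈ E, τ ≤ T.side ∧ T.side ≤ 4 * τ ∧ ∀ x ∈ S.toSet, ∀ y ∈ T.toSet, dist x y ≤ A * τ := by
  have hn' : (0 : ℝ) < √n := Real.sqrt_pos.2 (by exact_mod_cast hn)
  obtain ⟨N₀, hN₀⟩ := exists_nat_bound_of_le_log (a := 4 * √n) (b := 3) hκ (by positivity)
  refine ⟨1 + √n * (2 * N₀ + 4), le_add_of_nonneg_right (by positivity), ?_⟩
  intro O E hE hJ S hS R hR τ hSτ hτR
  have hτ : 0 < τ := S.side_pos.trans_le hSτ
  obtain ⟨m, c, hc, hd⟩ := hJ.exists_shortest_chain hκ hS hR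
  obtain ⟨k, hk⟩ := exists_pow_lt_of_lt_one (div_pos S.side_pos hτ) (show (1 / 2 : ℝ) < 1 by norm_num)
  rw [lt_div_iff₀ hτ, ← hc.1] at hk
  rw [← hc.2.1] at hτR
  obtain ⟨i, him, hi, hlt, hsum⟩ := hc.exists_first_large hE hκ hd hN₀ k τ hτ hk.le hτR
  have hi4 : (c i).side ≤ 4 * τ := by
    rcases Nat.eq_zero_or_pos i with h0 | h0
    · rw [h0, hc.1]
      linarith
    · have h2 := hlt (i - 1) (by omega)
      have h3 := hc.2.2.2 (i - 1) (by omega)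
      rw [show i - 1 + 1 = i by omega] at h3
      have := (hE.adjacent_le _ (hc.2.2.1 _ (by omega)) _ (hc.2.2.1 _ him) h3).2
      linarith
  refine ⟨c i, hc.2.2.1 i him, hi, hi4, fun x hx y hy => ?_⟩
  rw [← hc.1] at hx
  have := hc.dist_le (Nat.zero_le i) him hx hy
  rw [← Finset.range_eq_Ico, Finset.sum_range_succ] at this
  refine this.trans ?_
  calc √(n : ℝ) * (∑ j ∈ Finset.range i, (c j).side + (c i).side)
      ≤ √n * (2 * N₀ * τ + 4 * τ) := by gcongr
    _ ≤ (1 + √n * (2 * N₀ + 4)) * τ := by linarith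

end Whitney

/-! ### Porosity, diameter and matching cubes of a bounded Jones domain. -/

section BoundedJonesDomain

variable {Ω : Set (EuclideanSpace ℝ (Fin n))} {E : Set (Cube n)}

theorem compl_nonempty_of_isBounded (hn : 1 ≤ n) (hb : Bornology.IsBounded Ω) : Ωᶜ.Nonempty := by
  have : Nonempty (Fin n) := ⟨⟨0, hn⟩⟩
  rw [nonempty_compl]
  rintro rfl
  exact NormedSpace.unbounded_univ ℝ _ hb

theorem IsWhitney.bddAbove (hn : 1 ≤ n) (hb : Bornology.IsBounded Ω) (hE : IsWhitney Ω E) :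
    BddAbove (Cube.side '' E) := by
  obtain ⟨y, hy⟩ := compl_nonempty_of_isBounded hn hb
  obtain ⟨r, hr⟩ := hb.subset_closedBall y
  refine ⟨r, ?_⟩
  rintro _ ⟨S, hS, rfl⟩
  exact (hE.side_le hS S.corner_mem hy).trans (hr (hE.subset hS S.corner_mem))

theorem IsWhitney.side_le_maxSide (hn : 1 ≤ n) (hb : Bornology.IsBounded Ω) (hE : IsWhitney Ω E)
    {S : Cube n} (hS : S ∈ E) : S.side ≤ maxSide E :=
  le_csSup (hE.bddAbove hn hb) (mem_image_of_mem _ hS)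

theorem IsWhitney.nonempty (hE : IsWhitney Ω E) (hne : Ω.Nonempty) : E.Nonempty := by
  obtain ⟨x, hx⟩ := hne
  obtain ⟨S, hS, -⟩ := hE.exists_mem hx
  exact ⟨S, hS⟩

theorem IsWhitney.maxSide_pos (hn : 1 ≤ n) (hb : Bornology.IsBounded Ω) (hE : IsWhitney Ω E)
    (hne : Ω.Nonempty) : 0 < maxSide E := by
  obtain ⟨S, hS⟩ := hE.nonempty hne
  exact S.side_pos.trans_le (hE.side_le_maxSide hn hb hS)

/-- With half of the supremum no attainment is needed. -/
theorem IsWhitney.exists_half_maxSide_lt (hn : 1 ≤ n) (hb : Bornology.IsBounded Ω)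
    (hE : IsWhitney Ω E) (hne : Ω.Nonempty) : ∃ R ∈ E, maxSide E / 2 < R.side := by
  have := hE.maxSide_pos hn hb hne
  obtain ⟨_, ⟨R, hR, rfl⟩, h⟩ := exists_lt_of_lt_csSup ((hE.nonempty hne).image _)
    (show maxSide E / 2 < sSup (Cube.side '' E) from half_lt_self this)
  exact ⟨R, hR, h⟩

/-- Porosity of the boundary of a Jones domain. -/
theorem exists_cube_near_frontier (n : ℕ) (hn : 1 ≤ n) {κ : ℝ} (hκ : 0 < κ) : ∃ c : ℝ, 0 < c ∧
    c ≤ 1 ∧ ∀ (Ω : Set (EuclideanSpace ℝ (Fin n))) (E : Set (Cube n)), IsOpen Ω →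
      Bornology.IsBounded Ω → IsWhitney Ω E → JonesCondition κ E →
      ∀ z ∈ frontier Ω, ∀ r : ℝ, 0 < r → r ≤ maxSide E →
      ∃ T ∈ E, c * r ≤ T.side ∧ T.side ≤ r ∧ ∀ y ∈ T.toSet, dist z y ≤ r := by
  obtain ⟨A, hA, h⟩ := exists_near_large_cube n hn hκ
  refine ⟨1 / (A + 4), by positivity, by rw [div_le_one (by positivity)]; linarith, ?_⟩
  intro Ω E hΩ hb hE hJ z hz r hr hrL
  -- The cube T found at scale τ has side at most 4τ ≤ r and lies within (A + 1)τ ≤ r of z. Also τ ≤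
  -- r/5 lies below the side of R.
  set τ := r / (A + 4) with hτ
  have hτ0 : 0 < τ := by positivity
  have hr' : r = τ * (A + 4) := by rw [hτ]; field_simp
  have hzΩ : z ∉ Ω := by
    rw [hΩ.frontier_eq] at hz
    exact hz.2
  obtain ⟨x, hx, hxz⟩ := Metric.mem_closure_iff.1 (frontier_subset_closure hz) τ hτ0
  have hne : Ω.Nonempty := ⟨x, hx⟩
  obtain ⟨S, hS, hxS⟩ := hE.exists_mem hx
  obtain ⟨R, hR, hRL⟩ := hE.exists_half_maxSide_lt hn hb hne
  have hSτ : S.side ≤ τ := (hE.side_le hS hxS hzΩ).trans (by rw [dist_comm]; exact hxz.le)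
  have hA4 : τ * 5 ≤ r := by rw [hr']; gcongr; linarith
  obtain ⟨T, hT, h1, h2, h3⟩ := h Ω E hE hJ S hS R hR τ hSτ (by linarith)
  refine ⟨T, hT, ?_, by linarith, fun y hy => ?_⟩
  · rw [one_div_mul_eq_div]
    exact h1
  · have := h3 x hxS y hy
    have := dist_triangle z x y
    rw [hr']
    linarith

/-- The diameter of a Jones domain is controlled by the size of the largest Whitney cube. -/
theorem exists_dist_le_maxSide (n : ℕ) (hn : 1 ≤ n) {κ : ℝ} (hκ : 0 < κ) : ∃ A : ℝ, 1 ≤ A ∧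
    ∀ (Ω : Set (EuclideanSpace ℝ (Fin n))) (E : Set (Cube n)),
      Bornology.IsBounded Ω → IsWhitney Ω E → JonesCondition κ E →
      ∀ x ∈ Ω, ∀ y ∈ Ω, dist x y ≤ A * maxSide E := by
  have hn' : (0 : ℝ) < √n := Real.sqrt_pos.2 (by exact_mod_cast hn)
  obtain ⟨N₀, hN₀⟩ := exists_nat_bound_of_le_log (a := 4 * √n) (b := 3) hκ (by positivity)
  obtain ⟨A, hA, h⟩ := exists_near_large_cube n hn hκ
  have hA' : 1 ≤ A + √n * (N₀ + 1) := by
    have : 0 ≤ √(n : ℝ) * (N₀ + 1) := by positivity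
    linarith
  refine ⟨2 * (A + √n * (N₀ + 1)), by linarith, ?_⟩
  intro Ω E hb hE hJ
  rcases Ω.eq_empty_or_nonempty with rfl | hne
  · simp
  have hL := hE.maxSide_pos hn hb hne
  have hle := fun S hS => hE.side_le_maxSide hn hb (S := S) hS
  obtain ⟨R, hR, hRL⟩ := hE.exists_half_maxSide_lt hn hb hne
  set L := maxSide E with hLdef
  -- A shortest chain between two cubes of side at least L/2 has no cube larger than L, so its
  -- length is at most N₀.
  have hbig : ∀ T ∈ E, L / 2 ≤ T.side → ∀ x ∈ T.toSet, dist x R.corner ≤ √n * (N₀ + 1) * L := by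
    intro T hT hTL x hx
    obtain ⟨m, c, hc, hd⟩ := hJ.exists_shortest_chain hκ hT hR
    have hs : ∀ l ≤ m, (c l).side ≤ L := fun l hl => hle _ (hc.2.2.1 l hl)
    have hlen := hc.length_le hκ hd hN₀ (Nat.zero_le m) le_rfl (σ := L / 2)
      (by rw [hc.1]; exact hTL) (by rw [hc.2.1]; exact hRL.le)
      fun l _ hl => (hs l hl).trans (by linarith)
    rw [← hc.1] at hx
    have hd := hc.dist_le (Nat.zero_le m) le_rfl hx (y := R.corner)
      (by rw [hc.2.1]; exact R.corner_mem)
    refine hd.trans ?_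
    have h1 := Finset.sum_le_card_nsmul (Finset.Ico 0 (m + 1)) (fun l => (c l).side) L fun l hl => by
      rw [Finset.mem_Ico] at hl
      exact hs l (by omega)
    rw [Nat.card_Ico, nsmul_eq_mul] at h1
    have h2 : ((m + 1 - 0 : ℕ) : ℝ) ≤ N₀ + 1 := by
      have : m + 1 - 0 ≤ N₀ + 1 := by omega
      exact_mod_cast this
    calc _ ≤ √(n : ℝ) * ((N₀ + 1) * L) := by
          gcongr
          exact h1.trans (by gcongr)
      _ = _ := by ring
  have hall : ∀ x ∈ Ω, dist x R.corner ≤ (A + √n * (N₀ + 1)) * L := by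
    intro x hx
    obtain ⟨S, hS, hxS⟩ := hE.exists_mem hx
    have hAL : 0 ≤ A * L := by positivity
    rcases le_total (L / 2) S.side with h1 | h1
    · have := hbig S hS h1 x hxS
      linarith
    · obtain ⟨T, hT, h2, -, h3⟩ := h Ω E hE hJ S hS R hR (L / 2) h1 hRL.le
      have h4 := hbig T hT h2 _ T.corner_mem
      have h5 := h3 x hxS _ T.corner_mem
      have := dist_triangle x T.corner R.corner
      linarith
  intro x hx y hy
  have := dist_triangle_right x y R.corner
  have := hall x hx
  have := hall y hy
  linarith

/-- Matching cubes are close and of comparable size. -/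
theorem exists_matching_bound (n : ℕ) (hn : 1 ≤ n) {κ : ℝ} (hκ : 0 < κ) : ∃ A : ℝ, 1 ≤ A ∧
    ∀ (Ω : Set (EuclideanSpace ℝ (Fin n))) (E E' : Set (Cube n)), Ω.Nonempty →
      IsWhitney Ω E → IsWhitney (closure Ω)ᶜ E' → JonesCondition κ E →
      ∀ S' ∈ E', ∀ S, IsMatching E S' S → S.side ≤ A * S'.side ∧
        ∀ x ∈ S.toSet, ∀ y ∈ S'.toSet, dist x y ≤ A * S'.side := by
  have hn' : (0 : ℝ) < √n := Real.sqrt_pos.2 (by exact_mod_cast hn)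
  obtain ⟨A, hA, h⟩ := exists_near_large_cube n hn hκ
  set B := A + 6 * √n + 1 with hB
  have hB1 : 1 ≤ B := by linarith
  refine ⟨(2 * √n + 3) * B, by nlinarith, ?_⟩
  intro Ω E E' hne hE hE' hJ S' hS' S hS
  have hℓ := S'.side_pos
  obtain ⟨z, hz, hzS'⟩ := hE'.exists_dist_le hn (by rw [compl_compl]; exact hne.closure) hS'
  rw [notMem_compl_iff] at hz
  obtain ⟨w, hw, hzw⟩ := Metric.mem_closure_iff.1 hz S'.side hℓ
  obtain ⟨S₁, hS₁, hwS₁⟩ := hE.exists_mem hw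
  -- A competitor for the matching cube, near the point w of Ω close to S'. The cube S itself
  -- witnesses that cubes of this size occur.
  have hT : ∃ T ∈ E, S'.side ≤ T.side ∧ ∃ y ∈ T.toSet, dist w y ≤ A * S'.side := by
    rcases le_total S'.side S₁.side with h1 | h1
    · exact ⟨S₁, hS₁, h1, w, hwS₁, by rw [dist_self]; positivity⟩
    · obtain ⟨T, hT, h2, -, h3⟩ := h Ω E hE hJ S₁ hS₁ S hS.1 S'.side h1 hS.2.1
      exact ⟨T, hT, h2, T.corner, T.corner_mem, h3 w hwS₁ _ T.corner_mem⟩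
  obtain ⟨T, hT, hTS', y, hyT, hwy⟩ := hT
  have hd : setDist S.toSet S'.toSet < B * S'.side + S'.side := by
    have h1 := hS.2.2 T hT hTS'
    have h2 := setDist_le_dist hyT S'.corner_mem
    have h3 := hzS' _ S'.corner_mem
    have h4 := dist_triangle y w S'.corner
    have h5 := dist_triangle_right w S'.corner z
    rw [dist_comm z w] at hzw
    rw [dist_comm y w] at h4
    rw [hB]
    linarith
  obtain ⟨a, ha, b, hb, hab⟩ := exists_dist_lt_of_setDist_lt ⟨_, S.corner_mem⟩
    ⟨_, S'.corner_mem⟩ hd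
  have hbΩ : b ∉ Ω := fun hbΩ => hE'.subset hS' hb (subset_closure hbΩ)
  -- A Whitney cube is no larger than its distance to the complement of Ω, and b ∈ S' lies in that
  -- complement.
  have hside : S.side ≤ 2 * B * S'.side := by
    have := hE.side_le hS.1 ha hbΩ
    nlinarith
  refine ⟨hside.trans ?_, fun x hx y hy => ?_⟩
  · gcongr
    linarith
  · have h1 := dist_triangle x a y
    have h2 := dist_triangle a b y
    have h3 := Cube.dist_le hx ha
    have h4 := Cube.dist_le hb hy
    have h5 := mul_le_mul_of_nonneg_left hside hn'.le
    have h6 : √(n : ℝ) * S'.side ≤ B * S'.side := by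
      gcongr
      linarith
    nlinarith

end BoundedJonesDomain

/-! ### The boundary is porous at every scale, hence null. -/

section FrontierNull

/-- Uniform porosity of the boundary of a Jones domain, in terms of subdivisions of cubes. -/
theorem exists_grid_disjoint_frontier (n : ℕ) (hn : 1 ≤ n) {κ : ℝ} (hκ : 0 < κ) {B : ℝ}
    (hB : 1 ≤ B) : ∃ (N : ℕ) (hN : 0 < N),
      ∀ (Ω : Set (EuclideanSpace ℝ (Fin n))) (E : Set (Cube n)), IsOpen Ω →
      Bornology.IsBounded Ω → Ω.Nonempty → IsWhitney Ω E → JonesCondition κ E →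
      ∀ Q : Cube n, Q.side ≤ B * maxSide E →
        ∃ k, Disjoint (Q.grid hN k).toSet (frontier Ω) := by
  obtain ⟨c, hc0, hc1, h⟩ := exists_cube_near_frontier n hn hκ
  obtain ⟨N, hN8⟩ := exists_nat_ge (8 * B / c)
  have hN8' : 8 ≤ (N : ℝ) := by
    refine le_trans ?_ hN8
    rw [le_div_iff₀ hc0]
    nlinarith
  have hNr : (0 : ℝ) < N := by linarith
  have hN : 0 < N := by exact_mod_cast hNr
  refine ⟨N, hN, ?_⟩
  intro Ω E hΩ hb hne hE hJ Q hQ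
  have hℓ := Q.side_pos
  have hL := hE.maxSide_pos hn hb hne
  -- Either the cell at the centre of Q misses ∂Ω, or ∂Ω has a point in the middle half of Q. Then
  -- porosity puts in Q a Whitney cube T of side at least cℓ(Q)/(4B), and N ≥ 8B/c makes the cell at
  -- the centre of T fit into T.
  by_cases hcen : Disjoint (cubeAt Q.center (show 0 < Q.side / 4 by positivity)).toSet (frontier Ω)
  · obtain ⟨k, hk⟩ := Q.exists_grid_mem hN Q.center_mem
    refine ⟨k, hcen.mono_left fun x hx => mem_cubeAt.2 fun i => ?_⟩
    refine (abs_sub_le_side hx hk i).trans ?_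
    rw [Cube.grid_side]
    gcongr
    linarith
  · obtain ⟨z, hzc, hz⟩ := not_disjoint_iff.1 hcen
    set r := min (Q.side / 4) (maxSide E) with hr
    have hr0 : 0 < r := lt_min (by positivity) hL
    have hrB : Q.side / (4 * B) ≤ r := by
      refine le_min ?_ ?_
      · gcongr
        linarith
      · rw [div_le_iff₀ (by positivity)]
        nlinarith
    obtain ⟨T, hT, hTr, -, hTz⟩ := h Ω E hΩ hb hE hJ z hz r hr0 (min_le_right _ _)
    have hTQ : T.toSet ⊆ Q.toSet := by
      intro y hy i
      have h1 := abs_le.1 (abs_sub_le_dist z y i)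
      have h2 := (hTz y hy).trans (min_le_left _ _)
      have h3 := abs_le.1 (mem_cubeAt.1 hzc i)
      rw [Q.center_apply] at h3
      constructor <;> linarith
    obtain ⟨k, hk⟩ := Q.exists_grid_mem hN (hTQ T.center_mem)
    refine ⟨k, ?_⟩
    have hsub : (Q.grid hN k).toSet ⊆ T.toSet := by
      intro x hx i
      have hT0 := T.side_pos
      have h1 := abs_le.1 (abs_sub_le_side hx hk i)
      rw [Cube.grid_side, T.center_apply] at h1
      have h2 : Q.side / N ≤ T.side / 2 := by
        have h3 : c * (Q.side / (4 * B)) ≤ T.side := (mul_le_mul_of_nonneg_left hrB hc0.le).trans hTr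
        rw [div_le_iff₀ hNr]
        rw [div_le_iff₀ hc0] at hN8
        have h4 : Q.side = c * (Q.side / (4 * B)) * (4 * B / c) := by
          field_simp
        have h5 : 4 * B / c ≤ N / 2 := by
          rw [div_le_iff₀ hc0]
          linarith
        calc Q.side = c * (Q.side / (4 * B)) * (4 * B / c) := h4
          _ ≤ T.side * (N / 2) := by gcongr
          _ = _ := by ring
      constructor <;> linarith
    refine disjoint_left.2 fun x hx hxf => ?_
    rw [hΩ.frontier_eq] at hxf
    exact hxf.2 (hE.subset hT (hsub hx))

/-- The boundary of a bounded Jones domain is a null set. -/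
theorem volume_frontier_eq_zero (hn : 1 ≤ n) {κ : ℝ} (hκ : 0 < κ)
    {Ω : Set (EuclideanSpace ℝ (Fin n))} {E : Set (Cube n)} (hΩ : IsOpen Ω)
    (hb : Bornology.IsBounded Ω) (hne : Ω.Nonempty) (hE : IsWhitney Ω E)
    (hJ : JonesCondition κ E) : volume (frontier Ω) = 0 := by
  obtain ⟨N, hN, h⟩ := exists_grid_disjoint_frontier n hn hκ (le_refl (1 : ℝ))
  have hL := hE.maxSide_pos hn hb hne
  -- The density of ∂Ω in Q is bounded by the average of the densities in the cells, one of which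
  -- vanishes; with K = 0 absorption gives density zero.
  have key := self_improvement (n := n) hN (𝒬 := {Q : Cube n | Q.side ≤ maxSide E})
    (F := fun Q => volume (Q.toSet ∩ frontier Ω) / volume Q.toSet) (B := 1) (K := 0)
    ENNReal.one_ne_top (fun Q _ => ENNReal.div_le_of_le_mul (by
      rw [one_mul]; exact measure_mono inter_subset_left)) (fun Q hQ => by
    refine ⟨fun k => volume ((Q.grid hN k).toSet ∩ frontier Ω) / volume (Q.grid hN k).toSet, ?_,
      fun k => Or.inr ⟨?_, by rw [add_zero]⟩, ?_⟩
    · have hm0 : (Fintype.card (Fin n → Fin N) : ℝ≥0∞) ≠ 0 := by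
        have : Nonempty (Fin n → Fin N) := ⟨fun _ => ⟨0, hN⟩⟩
        exact_mod_cast Fintype.card_ne_zero
      have hmt : (Fintype.card (Fin n → Fin N) : ℝ≥0∞) ≠ ⊤ := ENNReal.natCast_ne_top _
      have e : ∀ k, (volume (Q.grid hN k).toSet)⁻¹
          = Fintype.card (Fin n → Fin N) * (volume Q.toSet)⁻¹ := by
        intro k
        rw [Q.volume_grid hN k, ENNReal.mul_inv (Or.inl hm0) (Or.inl hmt), ← mul_assoc,
          ENNReal.mul_inv_cancel hm0 hmt, one_mul]
      simp_rw [div_eq_mul_inv, e]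
      rw [← Finset.sum_mul]
      calc _ = volume (Q.toSet ∩ frontier Ω) * ((Fintype.card (Fin n → Fin N) : ℝ≥0∞) *
            (volume Q.toSet)⁻¹) := by ring
        _ ≤ _ := by
          gcongr
          refine (measure_mono (t := ⋃ k, (Q.grid hN k).toSet ∩ frontier Ω) ?_).trans
            (measure_iUnion_fintype_le _ _)
          rw [← iUnion_inter]
          exact inter_subset_inter_left _ (Q.subset_iUnion_grid hN)
    · exact (div_le_self Q.side_pos.le (by exact_mod_cast hN)).trans hQ
    · obtain ⟨k, hk⟩ := h Ω E hΩ hb hne hE hJ Q (by rw [one_mul]; exact hQ)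
      exact ⟨k, by simp [hk.inter_eq]⟩)
  refine measure_null_of_locally_null _ fun x _ => ?_
  set Q := cubeAt x (half_pos hL) with hQ
  have h0 := key Q (by simp [hQ]; linarith)
  rw [mul_zero, nonpos_iff_eq_zero, ENNReal.div_eq_zero_iff] at h0
  refine ⟨Q.toSet ∩ frontier Ω, ?_, h0.resolve_right Q.finPos.ne_top⟩
  rw [inter_comm]
  refine inter_mem_nhdsWithin _ (mem_interior_iff_mem_nhds.1 (Cube.mem_interior fun i => ?_))
  simp only [hQ, cubeAt_corner, cubeAt_side]
  constructor <;> linarith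

end FrontierNull

/-! ### Comparing means over nearby Whitney cubes. -/

section Comparison

/-- A cube containing `p` contains a substantial part of any small cube centred at `p`. -/
theorem exists_common_cube (S : Cube n) {p : EuclideanSpace ℝ (Fin n)} (hp : p ∈ S.toSet) {h : ℝ}
    (hh : 0 < h) (hS : 2 * h ≤ S.side) :
    ∃ I : Cube n, I.side = h ∧ I.toSet ⊆ S.toSet ∧ I.toSet ⊆ (cubeAt p hh).toSet := by
  classical
  -- In each coordinate the interval of length h starting at p is used if it fits in S, otherwise
  -- the one ending at p, which fits because 2h ≤ ℓ(S).
  refine ⟨⟨WithLp.toLp 2 fun i => if p i + h ≤ S.corner i + S.side then p i else p i - h, h, hh⟩,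
    rfl, fun x hx i => ?_, fun x hx => mem_cubeAt.2 fun i => ?_⟩
  · have h1 := hx i
    have h2 := hp i
    simp only at h1
    split_ifs at h1 with h3 <;> constructor <;> linarith
  · have h1 := hx i
    simp only at h1
    rw [abs_le]
    split_ifs at h1 with h3 <;> constructor <;> linarith

theorem meanDiff_le_of_center_mem {f : EuclideanSpace ℝ (Fin n) → ℝ} (hf : Measurable f)
    {P T : Cube n} (hp : P.center ∈ T.toSet) {c : ℝ} (hc : 1 ≤ c) (hPT : P.side ≤ c * T.side)
    (hTP : T.side ≤ c * P.side) : meanDiff f P.toSet T.toSet ≤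
      ENNReal.ofReal ((2 * c) ^ n) *
        (meanDiff f P.toSet P.toSet + meanDiff f T.toSet T.toSet) := by
  have h1 := P.side_pos
  have h2 := T.side_pos
  set h := min (T.side / 2) (P.side / 2) with hh
  have hh0 : 0 < h := lt_min (by positivity) (by positivity)
  obtain ⟨I, hI, hIT, hIP⟩ := exists_common_cube T hp hh0
    (by have := min_le_left (T.side / 2) (P.side / 2); linarith)
  have hP2 : P.side ≤ 2 * c * h := by
    rcases min_choice (T.side / 2) (P.side / 2) with h3 | h3 <;> rw [hh, h3] <;> nlinarith
  have hT2 : T.side ≤ 2 * c * h := by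
    rcases min_choice (T.side / 2) (P.side / 2) with h3 | h3 <;> rw [hh, h3] <;> nlinarith
  refine meanDiff_le_of_common hf (hIP.trans ?_) hIT P.finPos T.finPos I.finPos
    (Cube.volume_le_mul (by positivity) (by rwa [hI]))
    (Cube.volume_le_mul (by positivity) (by rwa [hI]))
  intro x hx i
  have h4 := abs_le.1 (mem_cubeAt.1 hx i)
  have h5 : h ≤ P.side / 2 := min_le_right _ _
  rw [P.center_apply] at h4
  constructor <;> linarith

variable {Ω : Set (EuclideanSpace ℝ (Fin n))} {E : Set (Cube n)}

/-- Touching cubes may share only a null set, so they are bridged by a cube centred at a common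
point, which overlaps both substantially. -/
theorem meanDiff_le_of_adjacent (hn : 1 ≤ n) (hE : IsWhitney Ω E)
    {f : EuclideanSpace ℝ (Fin n) → ℝ} (hf : Measurable f) {t : ℝ} {W : ℝ≥0∞}
    (hW : ∀ R : Cube n, R.toSet ⊆ Ω → R.side < t → meanDiff f R.toSet R.toSet ≤ W)
    {S T : Cube n} (hS : S ∈ E) (hT : T ∈ E) (hST : Adjacent S T) (hSt : S.side < t)
    (hTt : T.side < t) :
    meanDiff f S.toSet T.toSet ≤ ENNReal.ofReal ((8 * n : ℝ) ^ n) * 4 * W := by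
  have hn' : (1 : ℝ) ≤ n := by exact_mod_cast hn
  obtain ⟨p, hpS, hpT⟩ := hST.2
  obtain ⟨h1, h2⟩ := hE.adjacent_le S hS T hT hST
  have hS0 := S.side_pos
  have hT0 := T.side_pos
  set a := min S.side T.side with ha
  have ha0 : 0 < a := lt_min hS0 hT0
  have haS : a ≤ S.side := min_le_left _ _
  have haT : a ≤ T.side := min_le_right _ _
  have hSa : S.side ≤ 4 * a := by
    rcases min_choice S.side T.side with h3 | h3 <;> rw [ha, h3] <;> linarith
  have hTa : T.side ≤ 4 * a := by
    rcases min_choice S.side T.side with h3 | h3 <;> rw [ha, h3] <;> linarith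
  -- Points of the bridge are within √n h ≤ a/2 of p, less than the distance from p to the
  -- complement of Ω.
  set h := a / (2 * n) with hh
  have hh0 : 0 < h := by positivity
  have hah : a = 2 * n * h := by rw [hh]; field_simp
  have hha : 2 * h ≤ a := by rw [hah]; nlinarith
  set P := cubeAt p hh0 with hP
  have hsq : √(n : ℝ) ≤ n := by
    rw [Real.sqrt_le_left (by linarith)]
    nlinarith
  have hPΩ : P.toSet ⊆ Ω := by
    intro y hy
    by_contra hcon
    have h3 := hE.side_le hS hpS hcon
    have h4 : dist y p ≤ √n * h := dist_le_sqrt_mul hh0.le (mem_cubeAt.1 hy)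
    rw [dist_comm] at h4
    nlinarith
  have hPP : P.side = 2 * h := rfl
  have hPW := hW P hPΩ (by rw [hPP]; linarith)
  have key : ∀ T ∈ E, p ∈ T.toSet → T.side ≤ 4 * a → a ≤ T.side → T.side < t →
      meanDiff f P.toSet T.toSet ≤ ENNReal.ofReal ((8 * n : ℝ) ^ n) * 2 * W := by
    intro T hT hpT hTa haT hTt
    obtain ⟨I, hI, hIT, hIP⟩ := exists_common_cube T hpT hh0 (by linarith)
    refine (meanDiff_le_of_common hf hIP hIT P.finPos T.finPos I.finPos
      (Cube.volume_le_mul (c := 8 * n) (by positivity) ?_)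
      (Cube.volume_le_mul (c := 8 * n) (by positivity) ?_)).trans ?_
    · rw [hI, hPP]
      nlinarith
    · rw [hI]
      linarith
    · rw [mul_assoc, two_mul]
      gcongr
      exact hW T (hE.subset hT) hTt
  have hkS := key S hS hpS hSa haS hSt
  rw [meanDiff_comm hf] at hkS
  refine (meanDiff_triangle hf S.finPos P.finPos T.finPos).trans
    ((add_le_add hkS (key T hT hpT hTa haT hTt)).trans (le_of_eq ?_))
  ring

theorem IsWhitneyChain.meanDiff_le (hn : 1 ≤ n) (hE : IsWhitney Ω E)
    {f : EuclideanSpace ℝ (Fin n) → ℝ} (hf : Measurable f) {t : ℝ} {W : ℝ≥0∞}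
    (hW : ∀ R : Cube n, R.toSet ⊆ Ω → R.side < t → meanDiff f R.toSet R.toSet ≤ W)
    {Q R : Cube n} {m : ℕ} {c : ℕ → Cube n} (hc : IsWhitneyChain E Q R m c)
    (hQ : 4 ^ m * Q.side < t) :
    meanDiff f Q.toSet R.toSet ≤ (1 + m * (ENNReal.ofReal ((8 * n : ℝ) ^ n) * 4)) * W := by
  have hside : ∀ j ≤ m, (c j).side ≤ 4 ^ j * Q.side := by
    intro j
    induction j with
    | zero => simp [hc.1]
    | succ j ih =>
      intro hj
      have h1 := (hE.adjacent_le _ (hc.2.2.1 j (by omega)) _ (hc.2.2.1 _ hj)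
        (hc.2.2.2 j (by omega))).2
      have := ih (by omega)
      rw [pow_succ]
      linarith
  have hlt : ∀ j ≤ m, (c j).side < t := by
    intro j hj
    refine (hside j hj).trans_lt (lt_of_le_of_lt ?_ hQ)
    have := Q.side_pos
    gcongr
    norm_num
  have hind : ∀ j ≤ m, meanDiff f (c 0).toSet (c j).toSet ≤
      (1 + j * (ENNReal.ofReal ((8 * n : ℝ) ^ n) * 4)) * W := by
    intro j
    induction j with
    | zero =>
      intro _
      simpa using hW _ (hE.subset (hc.2.2.1 0 (Nat.zero_le _))) (hlt 0 (Nat.zero_le _))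
    | succ j ih =>
      intro hj
      refine (meanDiff_triangle hf (c 0).finPos (c j).finPos (c (j + 1)).finPos).trans ?_
      refine (add_le_add (ih (by omega)) (meanDiff_le_of_adjacent hn hE hf hW
        (hc.2.2.1 _ (by omega)) (hc.2.2.1 _ hj) (hc.2.2.2 j (by omega)) (hlt _ (by omega))
        (hlt _ hj))).trans (le_of_eq ?_)
      push_cast
      ring
  have := hind m le_rfl
  rwa [hc.1, hc.2.1] at this

/-- Whitney cubes of comparable size and position have a small mean difference. -/
theorem exists_meanDiff_le_of_comparable (n : ℕ) (hn : 1 ≤ n) {κ : ℝ} (hκ : 0 < κ) {A : ℝ}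
    (hA : 1 ≤ A) : ∃ (K : ℝ) (C : ℝ≥0), 1 ≤ K ∧
      ∀ (Ω : Set (EuclideanSpace ℝ (Fin n))) (E : Set (Cube n)), IsWhitney Ω E →
      JonesCondition κ E → ∀ f : EuclideanSpace ℝ (Fin n) → ℝ, Measurable f →
      ∀ (t : ℝ) (W : ℝ≥0∞),
      (∀ R : Cube n, R.toSet ⊆ Ω → R.side < t → meanDiff f R.toSet R.toSet ≤ W) →
      ∀ s : ℝ, K * s < t → ∀ S ∈ E, ∀ R ∈ E, s ≤ A * S.side → S.side ≤ A * s →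
        s ≤ A * R.side → R.side ≤ A * s →
        ∀ x ∈ S.toSet, ∀ y ∈ R.toSet, dist x y ≤ A * s →
        meanDiff f S.toSet R.toSet ≤ C * W := by
  obtain ⟨M, hM⟩ := exists_nat_ge (κ * (Real.logb 2 (A * A) + Real.logb 2 (2 + A * A)))
  -- M bounds the length of the chain. Sides grow at most fourfold per step, so 4^M A bounds every
  -- cube on it relative to s.
  refine ⟨4 ^ M * A, 1 + M * (Real.toNNReal ((8 * n : ℝ) ^ n) * 4), ?_, ?_⟩
  · exact one_le_mul_of_one_le_of_one_le (one_le_pow₀ (by norm_num)) hA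
  intro Ω E hE hJ f hf t W hW s hs S hS R hR hsS hSs hsR hRs x hx y hy hxy
  have hS0 := S.side_pos
  have hR0 := R.side_pos
  obtain ⟨m, c, hc, hd⟩ := hJ.exists_shortest_chain hκ hS hR
  have hd0 := hd 0 m (Nat.zero_le _) le_rfl
  rw [hc.1, hc.2.1, Nat.sub_zero] at hd0
  have h1 : d₂ S R ≤ Real.logb 2 (A * A) + Real.logb 2 (2 + A * A) := by
    refine d₂_le ?_ ?_ hx hy ?_ <;> nlinarith
  have hmM : m ≤ M := by
    have := (hd0.trans (mul_le_mul_of_nonneg_left h1 hκ.le)).trans hM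
    exact_mod_cast this
  refine (hc.meanDiff_le hn hE hf hW (lt_of_le_of_lt ?_ hs)).trans ?_
  · rw [mul_assoc]
    gcongr
    norm_num
  · gcongr
    push_cast
    rw [ENNReal.ofReal]
    gcongr

end Comparison

/-! ### The enlarged domain. -/

section Enlarged

variable {Ω : Set (EuclideanSpace ℝ (Fin n))} {E E' : Set (Cube n)}

/-- A cube is convex, hence connected, and off ∂Ω the open sets Ω and the exterior separate space.
-/
theorem Cube.subset_or_subset_of_disjoint_frontier (hΩ : IsOpen Ω) {Q : Cube n}
    (h : Disjoint Q.toSet (frontier Ω)) : Q.toSet ⊆ Ω ∨ Q.toSet ⊆ (closure Ω)ᶜ := by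
  refine Q.convex.isPreconnected.subset_or_subset hΩ isClosed_closure.isOpen_compl
    (disjoint_compl_right.mono_left subset_closure) fun x hx => ?_
  by_contra hcon
  simp only [mem_union, mem_compl_iff, not_or, not_not] at hcon
  refine disjoint_left.1 h hx ?_
  rw [hΩ.frontier_eq]
  exact ⟨hcon.2, hcon.1⟩

theorem mem_smallExterior_of_mem_enlarged {x : EuclideanSpace ℝ (Fin n)}
    (hx : x ∈ enlarged Ω E E') (hx' : x ∉ closure Ω) : x ∈ smallExterior E E' :=
  (interior_subset hx).resolve_left hx'

theorem exists_cube_of_mem_smallExterior {x : EuclideanSpace ℝ (Fin n)}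
    (hx : x ∈ smallExterior E E') : ∃ S ∈ E', S.side ≤ maxSide E ∧ x ∈ S.toSet := by
  simp only [smallExterior, mem_iUnion, mem_ofPred_eq] at hx
  obtain ⟨S, ⟨hS, hSL⟩, hxS⟩ := hx
  exact ⟨S, hS, hSL, hxS⟩

theorem Cube.subset_smallExterior {S : Cube n} (hS : S ∈ E') (hSL : S.side ≤ maxSide E) :
    S.toSet ⊆ smallExterior E E' :=
  subset_biUnion_of_mem (s := {S' ∈ E' | S'.side ≤ maxSide E}) (u := Cube.toSet) ⟨hS, hSL⟩

/-- The cubes in the enlarged domain are not much larger than the largest Whitney cube. -/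
theorem exists_side_le_of_subset_enlarged (n : ℕ) (hn : 1 ≤ n) {κ : ℝ} (hκ : 0 < κ) :
    ∃ B : ℝ, 1 ≤ B ∧ ∀ (Ω : Set (EuclideanSpace ℝ (Fin n))) (E E' : Set (Cube n)),
      Bornology.IsBounded Ω → Ω.Nonempty → IsWhitney Ω E → IsWhitney (closure Ω)ᶜ E' →
      JonesCondition κ E → ∀ Q : Cube n, Q.toSet ⊆ enlarged Ω E E' → Q.side ≤ B * maxSide E := by
  obtain ⟨A, hA, h⟩ := exists_dist_le_maxSide n hn hκ
  have h0 : 0 ≤ √(n : ℝ) := Real.sqrt_nonneg _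
  refine ⟨2 * (6 * √n + 1) + A, by linarith, ?_⟩
  intro Ω E E' hb hne hE hE' hJ Q hQ
  have hL := hE.maxSide_pos hn hb hne
  -- The enlarged set stays within a multiple of `maxSide E` of Ω, whose diameter is also so
  -- bounded; applying this to opposite corners of Q bounds its side.
  have key : ∀ x ∈ enlarged Ω E E', ∃ w ∈ Ω, dist x w ≤ (6 * √n + 1) * maxSide E := by
    intro x hx
    obtain ⟨z, hz, hxz⟩ : ∃ z ∈ closure Ω, dist x z ≤ 6 * √n * maxSide E := by
      by_cases hx' : x ∈ closure Ω
      · exact ⟨x, hx', by rw [dist_self]; positivity⟩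
      · obtain ⟨S, hS, hSL, hxS⟩ :=
          exists_cube_of_mem_smallExterior (mem_smallExterior_of_mem_enlarged hx hx')
        obtain ⟨z, hz, hz'⟩ := hE'.exists_dist_le hn (by rw [compl_compl]; exact hne.closure) hS
        exact ⟨z, notMem_compl_iff.1 hz, (hz' x hxS).trans (by gcongr)⟩
    obtain ⟨w, hw, hzw⟩ := Metric.mem_closure_iff.1 hz _ hL
    refine ⟨w, hw, ?_⟩
    have := dist_triangle x z w
    linarith
  set y : EuclideanSpace ℝ (Fin n) := WithLp.toLp 2 fun i => Q.corner i + Q.side with hy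
  have hyQ : y ∈ Q.toSet := fun i => ⟨by simp [hy, Q.side_pos.le], by simp [hy]⟩
  obtain ⟨w, hw, hxw⟩ := key _ (hQ Q.corner_mem)
  obtain ⟨v, hv, hyv⟩ := key _ (hQ hyQ)
  have h1 := abs_sub_le_dist y Q.corner ⟨0, hn⟩
  have h2 : y ⟨0, hn⟩ - Q.corner ⟨0, hn⟩ = Q.side := by simp [hy]
  rw [h2, abs_of_pos Q.side_pos] at h1
  have h3 := dist_triangle y v Q.corner
  have h4 := dist_triangle v w Q.corner
  have h5 := h Ω E hb hE hJ v hv w hw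
  rw [dist_comm w] at h4
  linarith

end Enlarged

/-! ### The oscillation over cubes meeting the boundary. -/

section Gluing

set_option maxHeartbeats 1000000 in
/-- The mean oscillation in the enlarged domain, for functions with controlled oscillation inside
and outside and controlled mean differences of matching cubes. -/
theorem exists_meanDiff_le_of_subset_enlarged (n : ℕ) (hn : 1 ≤ n) {κ : ℝ} (hκ : 0 < κ) :
    ∃ (K : ℝ) (C : ℝ≥0), 1 ≤ K ∧
      ∀ (Ω : Set (EuclideanSpace ℝ (Fin n))) (E E' : Set (Cube n)), IsOpen Ω →
      Bornology.IsBounded Ω → Ω.Nonempty → IsWhitney Ω E → IsWhitney (closure Ω)ᶜ E' →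
      JonesCondition κ E → ∀ f : EuclideanSpace ℝ (Fin n) → ℝ, Measurable f →
      ∀ (t : ℝ) (W : ℝ≥0∞),
      (∀ R : Cube n, R.toSet ⊆ Ω → R.side < K * t → meanDiff f R.toSet R.toSet ≤ W) →
      (∀ R : Cube n, R.toSet ⊆ smallExterior E E' → R.side < K * t →
        meanDiff f R.toSet R.toSet ≤ W) →
      (∀ S' ∈ E', S'.side ≤ maxSide E → S'.side < K * t →
        ∃ S, IsMatching E S' S ∧ meanDiff f S'.toSet S.toSet ≤ W) →
      ∀ Q : Cube n, Q.toSet ⊆ enlarged Ω E E' → Q.side < t →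
        meanDiff f Q.toSet Q.toSet ≤ C * W := by
  obtain ⟨B, hB, hside⟩ := exists_side_le_of_subset_enlarged n hn hκ
  obtain ⟨c, hc0, hc1, hpor⟩ := exists_cube_near_frontier n hn hκ
  obtain ⟨N, hN, hgrid⟩ := exists_grid_disjoint_frontier n hn hκ hB
  obtain ⟨A₁, hA₁, hmatch⟩ := exists_matching_bound n hn hκ
  have hNr : (0 : ℝ) < N := by exact_mod_cast hN
  have hN1 : (1 : ℝ) ≤ N := by exact_mod_cast hN
  have hn' : (1 : ℝ) ≤ √n := Real.one_le_sqrt.2 (by exact_mod_cast hn)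
  set A₂ : ℝ := 12 * √n * N with hA₂
  have hA₂1 : 1 ≤ A₂ := by rw [hA₂]; nlinarith
  -- One constant covering all ratios to ℓ(Q): N B / c for reference cubes of Q and its cells, A₂
  -- for Whitney cubes at centres of cells, A₁√n for their matching cubes, √n + 2 for distances
  -- between reference cubes.
  set A : ℝ := N * B / c + A₂ + A₁ * √n + √n + 2 with hA
  have hNBc : 0 < N * B / c := by positivity
  have hA₁n : 1 ≤ A₁ * √n := one_le_mul_of_one_le_of_one_le hA₁ hn'
  have hA1 : 1 ≤ A := by linarith
  obtain ⟨K₀, C₀, hK₀, hcomp⟩ := exists_meanDiff_le_of_comparable n hn hκ hA1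
  -- The three summands pay for the overlap with a Whitney cube, the passage to its matching cube,
  -- and the chain in Ω.
  set C₁ : ℝ≥0 := Real.toNNReal ((2 * A₂) ^ n) * 2 + 1 + C₀ with hC₁
  set m : ℝ≥0 := (Fintype.card (Fin n → Fin N) : ℝ≥0) with hm
  refine ⟨K₀ + √n, 1 + 2 * (m * C₁), by linarith, ?_⟩
  intro Ω E E' hΩ hb hne hE hE' hJ f₀ hf₀ t W hin hout hmat Q₀ hQ₀ hQ₀t
  have ht : 0 < t := Q₀.side_pos.trans hQ₀t
  have htK : t ≤ (K₀ + √n) * t := by nlinarith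
  have hL := hE.maxSide_pos hn hb hne
  have hout' : ∀ P : Cube n, P.toSet ⊆ enlarged Ω E E' → P.toSet ⊆ (closure Ω)ᶜ →
      P.toSet ⊆ smallExterior E E' := fun P h1 h2 x hx =>
    mem_smallExterior_of_mem_enlarged (h1 hx) (h2 hx)
  by_cases hQf : Disjoint Q₀.toSet (frontier Ω)
  · have hW : meanDiff f₀ Q₀.toSet Q₀.toSet ≤ W := by
      rcases Cube.subset_or_subset_of_disjoint_frontier hΩ hQf with h1 | h1
      · exact hin _ h1 (hQ₀t.trans_le htK)
      · exact hout _ (hout' _ hQ₀ h1) (hQ₀t.trans_le htK)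
    refine hW.trans ?_
    nth_rewrite 1 [← one_mul W]
    gcongr
    push_cast
    exact le_self_add
  refine meanDiff_le_of_truncate_le hf₀ Q₀.finPos Q₀.finPos fun k => ?_
  set f := truncate k f₀ with hf
  have hfm : Measurable f := measurable_truncate k hf₀
  replace hin : ∀ R : Cube n, R.toSet ⊆ Ω → R.side < (K₀ + √n) * t →
      meanDiff f R.toSet R.toSet ≤ W := fun R h1 h2 =>
    (meanDiff_truncate_le _ _ _ _).trans (hin R h1 h2)
  replace hout : ∀ R : Cube n, R.toSet ⊆ smallExterior E E' → R.side < (K₀ + √n) * t →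
      meanDiff f R.toSet R.toSet ≤ W := fun R h1 h2 =>
    (meanDiff_truncate_le _ _ _ _).trans (hout R h1 h2)
  replace hmat : ∀ S' ∈ E', S'.side ≤ maxSide E → S'.side < (K₀ + √n) * t →
      ∃ S, IsMatching E S' S ∧ meanDiff f S'.toSet S.toSet ≤ W := fun S' h1 h2 h3 => by
    obtain ⟨S, h4, h5⟩ := hmat S' h1 h2 h3
    exact ⟨S, h4, (meanDiff_truncate_le _ _ _ _).trans h5⟩
  set 𝒬 : Set (Cube n) := {Q | Q.toSet ⊆ enlarged Ω E E' ∧ (Q.toSet ∩ frontier Ω).Nonempty ∧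
    Q.side < t} with h𝒬
  -- Porosity at radius min(ℓ(Q), `maxSide E`), which is at least ℓ(Q)/B. Outside 𝒬 the value Q is a
  -- dummy.
  have href : ∀ Q : Cube n, ∃ S : Cube n, Q ∈ 𝒬 → S ∈ E ∧ c / B * Q.side ≤ S.side ∧
      S.side ≤ Q.side ∧ ∃ z ∈ Q.toSet, ∀ y ∈ S.toSet, dist z y ≤ Q.side := by
    intro Q
    by_cases hQ : Q ∈ 𝒬
    · obtain ⟨z, hzQ, hz⟩ := hQ.2.1
      have hr0 : 0 < min Q.side (maxSide E) := lt_min Q.side_pos hL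
      obtain ⟨T, hT, h1, h2, h3⟩ := hpor Ω E hΩ hb hE hJ z hz _ hr0 (min_le_right _ _)
      have hQr : Q.side / B ≤ min Q.side (maxSide E) := by
        refine le_min (div_le_self Q.side_pos.le hB) ?_
        rw [div_le_iff₀ (by linarith), mul_comm]
        exact hside Ω E E' hb hne hE hE' hJ Q hQ.1
      refine ⟨T, fun _ => ⟨hT, ?_, h2.trans (min_le_left _ _), z, hzQ,
        fun y hy => (h3 y hy).trans (min_le_left _ _)⟩⟩
      refine le_trans ?_ h1
      rw [div_mul_eq_mul_div, mul_div_assoc]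
      gcongr
    · exact ⟨Q, fun h => absurd h hQ⟩
  choose S hS using href
  have hSI := self_improvement (n := n) hN (𝒬 := 𝒬)
    (F := fun Q => meanDiff f Q.toSet (S Q).toSet) (B := ENNReal.ofReal (2 * k)) (K := C₁ * W)
    ENNReal.ofReal_ne_top (fun Q _ => meanDiff_le_of_abs_le (abs_truncate_le k f₀) _ _) ?_ Q₀
    ⟨hQ₀, not_disjoint_iff_nonempty_inter.1 hQf, hQ₀t⟩
  · refine (meanDiff_self_le hfm Q₀.finPos (S Q₀).finPos).trans ?_
    calc _ ≤ 2 * ((Fintype.card (Fin n → Fin N) : ℝ≥0∞) * (C₁ * W)) := by gcongr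
      _ ≤ W + 2 * ((Fintype.card (Fin n → Fin N) : ℝ≥0∞) * (C₁ * W)) := le_add_self
      _ = _ := by rw [hm]; push_cast; ring
  intro Q hQ
  obtain ⟨hSE, hSQ, hSQ', z, hzQ, hz⟩ := hS Q hQ
  obtain ⟨zf, hzfQ, hzf⟩ := hQ.2.1
  have hzfΩ : zf ∉ Ω := by
    rw [hΩ.frontier_eq] at hzf
    exact hzf.2
  have hℓ := Q.side_pos
  set ℓ := Q.side with hℓdef
  have hℓt : ℓ < t := hQ.2.2
  have hKℓ : K₀ * ℓ < (K₀ + √n) * t := by nlinarith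
  have hnℓ : √n * ℓ < (K₀ + √n) * t := by nlinarith
  have hAS : ℓ ≤ A * (S Q).side := by
    have h1 : ℓ ≤ N * B / c * (S Q).side := by
      have h2 : N * B / c * (c / B * ℓ) ≤ N * B / c * (S Q).side := by gcongr
      refine le_trans ?_ h2
      have h3 : N * B / c * (c / B * ℓ) = N * ℓ := by field_simp
      rw [h3]
      nlinarith
    have h4 : N * B / c * (S Q).side ≤ A * (S Q).side :=
      mul_le_mul_of_nonneg_right (by linarith) (S Q).side_pos.le
    linarith
  have hSA : (S Q).side ≤ A * ℓ := by nlinarith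
  have hfar : ∀ x ∈ Q.toSet, ∀ y ∈ (S Q).toSet, dist x y ≤ (√n + 1) * ℓ := by
    intro x hx y hy
    have h1 := Cube.dist_le hx hzQ
    have h2 := hz y hy
    have h3 := dist_triangle x z y
    linarith
  have hC₁ : (C₁ : ℝ≥0∞) = ENNReal.ofReal ((2 * A₂) ^ n) * 2 + 1 + C₀ := by
    rw [hC₁, ENNReal.ofReal]
    push_cast
    rfl
  -- The Whitney cube T at the centre of the cell P is comparable to Q: it is not too large because
  -- Q meets ∂Ω, and not too small because P misses ∂Ω.
  have hgood : ∀ k, Disjoint (Q.grid hN k).toSet (frontier Ω) →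
      meanDiff f (Q.grid hN k).toSet (S Q).toSet ≤ C₁ * W := by
    intro k hk
    set P := Q.grid hN k with hP
    have hPs : P.side = ℓ / N := rfl
    have hPQ : P.toSet ⊆ Q.toSet := Q.grid_subset hN k
    have hPℓ : P.side ≤ ℓ := div_le_self hℓ.le hN1
    have hPt : P.side < (K₀ + √n) * t := by linarith
    have hNP : ℓ = N * P.side := by rw [hPs]; field_simp
    have hoverlap : ∀ T : Cube n, P.center ∈ T.toSet → T.side ≤ √n * ℓ →
        P.side / 2 ≤ 6 * √n * T.side → meanDiff f P.toSet P.toSet ≤ W →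
        meanDiff f T.toSet T.toSet ≤ W →
        ℓ ≤ A₂ * T.side ∧ meanDiff f P.toSet T.toSet ≤ ENNReal.ofReal ((2 * A₂) ^ n) * 2 * W := by
      intro T hPT hT hT' hPW hTW
      have h1 : ℓ ≤ A₂ * T.side := by
        rw [hNP, hA₂]
        calc N * P.side = 2 * N * (P.side / 2) := by ring
          _ ≤ 2 * N * (6 * √n * T.side) := by gcongr
          _ = _ := by ring
      refine ⟨h1, ?_⟩
      refine (meanDiff_le_of_center_mem hfm hPT hA₂1 (hPℓ.trans h1) ?_).trans ?_
      · rw [hNP] at hT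
        have h3 : 0 ≤ √n * (N * P.side) := by have := P.side_pos; positivity
        rw [hA₂]
        linarith
      · calc _ ≤ ENNReal.ofReal ((2 * A₂) ^ n) * (W + W) := by gcongr
          _ = _ := by ring
    rcases Cube.subset_or_subset_of_disjoint_frontier hΩ hk with hPΩ | hPΩ
    · obtain ⟨T, hT, hPT⟩ := hE.exists_mem (hPΩ P.center_mem)
      have hT1 : T.side ≤ √n * ℓ :=
        (hE.side_le hT hPT hzfΩ).trans (Cube.dist_le (hPQ P.center_mem) hzfQ)
      obtain ⟨y, hy, hyT⟩ := hE.exists_dist_le hn (compl_nonempty_of_isBounded hn hb) hT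
      have hT2 : P.side / 2 ≤ 6 * √n * T.side :=
        (P.center_margin fun h => hy (hPΩ (interior_subset h))).trans (hyT _ hPT)
      obtain ⟨h1, h2⟩ := hoverlap T hPT hT1 hT2 (hin P hPΩ hPt)
        (hin T (hE.subset hT) (by linarith))
      have h3 := hcomp Ω E hE hJ f hfm _ W hin ℓ hKℓ T hT (S Q) hSE
        (h1.trans (by have := T.side_pos; gcongr; linarith))
        (hT1.trans (by gcongr; linarith)) hAS hSA P.center hPT (S Q).corner (S Q).corner_mem
        ((hfar _ (hPQ P.center_mem) _ (S Q).corner_mem).trans (by gcongr; linarith))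
      refine (meanDiff_triangle hfm P.finPos T.finPos (S Q).finPos).trans
        ((add_le_add h2 h3).trans ?_)
      rw [hC₁, ← add_mul]
      gcongr
      exact le_self_add
    · have hcen : P.center ∈ enlarged Ω E E' := hQ.1 (hPQ P.center_mem)
      obtain ⟨T, hT, hTL, hPT⟩ := exists_cube_of_mem_smallExterior
        (mem_smallExterior_of_mem_enlarged hcen (hPΩ P.center_mem))
      have hzf' : zf ∉ (closure Ω)ᶜ := notMem_compl_iff.2 (frontier_subset_closure hzf)
      have hT1 : T.side ≤ √n * ℓ :=
        (hE'.side_le hT hPT hzf').trans (Cube.dist_le (hPQ P.center_mem) hzfQ)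
      obtain ⟨y, hy, hyT⟩ := hE'.exists_dist_le hn (by rw [compl_compl]; exact hne.closure) hT
      have hT2 : P.side / 2 ≤ 6 * √n * T.side :=
        (P.center_margin fun h => hy (hPΩ (interior_subset h))).trans (hyT _ hPT)
      obtain ⟨h1, h2⟩ := hoverlap T hPT hT1 hT2 (hout P (hout' P (hPQ.trans hQ.1) hPΩ) hPt)
        (hout T (Cube.subset_smallExterior hT hTL) (by linarith))
      -- An exterior cell crosses into Ω through the matching cube R of T; from there the comparison
      -- runs along chains in Ω.
      obtain ⟨R, hR, hRW⟩ := hmat T hT hTL (by linarith)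
      obtain ⟨hR1, hR2⟩ := hmatch Ω E E' hne hE hE' hJ T hT R hR
      have hA₁T : A₁ * T.side ≤ A₁ * √n * ℓ := by
        rw [mul_assoc]
        gcongr
      have h3 := hcomp Ω E hE hJ f hfm _ W hin ℓ hKℓ R hR.1 (S Q) hSE
        (h1.trans (by
          have := T.side_pos
          have := hR.2.1
          gcongr
          linarith))
        (hR1.trans (hA₁T.trans (by gcongr; linarith))) hAS hSA R.corner R.corner_mem
        (S Q).corner (S Q).corner_mem (by
          have h4 := hR2 _ R.corner_mem _ hPT
          have h5 := hfar _ (hPQ P.center_mem) _ (S Q).corner_mem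
          have h6 := dist_triangle R.corner P.center (S Q).corner
          have h7 : A₁ * √n * ℓ + (√n + 1) * ℓ ≤ A * ℓ := by
            rw [← add_mul]
            gcongr
            linarith
          linarith)
      refine (meanDiff_triangle hfm P.finPos R.finPos (S Q).finPos).trans
        ((add_le_add ((meanDiff_triangle hfm P.finPos T.finPos R.finPos).trans
          (add_le_add h2 hRW)) h3).trans (le_of_eq ?_))
      rw [hC₁]
      ring
  refine ⟨fun k => meanDiff f (Q.grid hN k).toSet (S Q).toSet,
    card_mul_meanDiff_le_sum _ Q.finPos (Q.subset_iUnion_grid hN) (Q.volume_grid hN),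
    fun k => ?_, ?_⟩
  swap
  · obtain ⟨k, hk⟩ := hgrid Ω E hΩ hb hne hE hJ Q (hside Ω E E' hb hne hE hE' hJ Q hQ.1)
    exact ⟨k, hgood k hk⟩
  by_cases hk : Disjoint (Q.grid hN k).toSet (frontier Ω)
  · exact Or.inl (hgood k hk)
  have hPℓ : (Q.grid hN k).side ≤ ℓ := div_le_self hℓ.le hN1
  have hPQ : (Q.grid hN k).toSet ⊆ Q.toSet := Q.grid_subset hN k
  have hP𝒬 : Q.grid hN k ∈ 𝒬 :=
    ⟨hPQ.trans hQ.1, not_disjoint_iff_nonempty_inter.1 hk, hPℓ.trans_lt hℓt⟩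
  refine Or.inr ⟨hP𝒬, ?_⟩
  set P := Q.grid hN k with hP
  have hPs : P.side = ℓ / N := rfl
  have hNP : ℓ = N * P.side := by rw [hPs]; field_simp
  obtain ⟨hPE, hSP, hSP', w, hwP, hw⟩ := hS P hP𝒬
  -- A cell meeting ∂Ω returns F(P), plus the cost of the chain between the two reference cubes.
  refine (meanDiff_triangle hfm P.finPos (S P).finPos (S Q).finPos).trans
    (add_le_add le_rfl ?_)
  refine (hcomp Ω E hE hJ f hfm _ W hin ℓ hKℓ (S P) hPE (S Q) hSE ?_ ?_ hAS hSA
    (S P).corner (S P).corner_mem (S Q).corner (S Q).corner_mem ?_).trans ?_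
  · have h1 : N * B / c * (c / B * P.side) ≤ N * B / c * (S P).side := by gcongr
    have h2 : N * B / c * (c / B * P.side) = ℓ := by rw [hNP]; field_simp
    have h4 : N * B / c * (S P).side ≤ A * (S P).side :=
      mul_le_mul_of_nonneg_right (by linarith) (S P).side_pos.le
    linarith
  · exact hSP'.trans (hPℓ.trans (le_mul_of_one_le_left hℓ.le hA1))
  · have h1 := hw _ (S P).corner_mem
    have h2 := hfar _ (hPQ hwP) _ (S Q).corner_mem
    have h3 := dist_triangle_left (S P).corner (S Q).corner w
    have h4 : ℓ + (√n + 1) * ℓ ≤ A * ℓ := by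
      rw [← one_add_mul]
      exact mul_le_mul_of_nonneg_right (by linarith) hℓ.le
    linarith
  · rw [hC₁]
    gcongr
    exact le_add_self

end Gluing

/-! ### Translation into the modulus of mean oscillation. -/

section Oscillation

theorem meanOsc_eq_meanDiff (f : EuclideanSpace ℝ (Fin n) → ℝ) (Q : Cube n) :
    meanOsc f Q = meanDiff f Q.toSet Q.toSet := by
  rw [meanOsc, meanDiff, sq]

theorem meanOsc_le_oscModulus {O : Set (EuclideanSpace ℝ (Fin n))}
    (f : EuclideanSpace ℝ (Fin n) → ℝ) {Q : Cube n} {t : ℝ} (hQ : IsInteriorCube O Q)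
    (ht : Q.side < t) : meanOsc f Q ≤ oscModulus O f t :=
  le_iSup_of_le Q (le_iSup_of_le hQ (le_iSup_of_le ht le_rfl))

theorem ae_restrict_eq_of_null_diff {X : Type*} [MeasurableSpace X] {μ : Measure X} {U A : Set X}
    {f g : X → ℝ} (hU : MeasurableSet U) (hA : MeasurableSet A)
    (hfg : f =ᵐ[μ.restrict U] g) (h : μ (A \ U) = 0) : f =ᵐ[μ.restrict A] g := by
  have h1 := (ae_restrict_iff' hU).1 hfg
  refine (ae_restrict_iff' hA).2 ?_
  filter_upwards [h1, measure_eq_zero_iff_ae_notMem.1 h] with x hx hx' hxA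
  by_contra hcon
  exact hx' ⟨hxA, fun hxU => hcon (hx hxU)⟩

/-- The mean oscillation over cubes in an open set in terms of the modulus of mean oscillation. -/
theorem exists_meanDiff_le_oscModulus (n : ℕ) (hn : 1 ≤ n) : ∃ C : ℝ≥0, 1 ≤ C ∧
    ∀ (O U : Set (EuclideanSpace ℝ (Fin n))), IsOpen O → MeasurableSet U → O ⊆ U →
      ∀ f g : EuclideanSpace ℝ (Fin n) → ℝ, Measurable g →
      g =ᵐ[volume.restrict U] f → ∀ (t : ℝ) (R : Cube n), interior R.toSet ⊆ O → R.side < t →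
      meanDiff g R.toSet R.toSet ≤ C * oscModulus O f t := by
  obtain ⟨C, hC, h⟩ := exists_meanDiff_cube_le n hn
  refine ⟨C, hC, fun O U hO hU hOU f g hg hfg t R hR hRt => h g hg R _ fun P hPR hside hP => ?_⟩
  have : Nonempty (Fin n) := ⟨⟨0, hn⟩⟩
  -- Positivity of the diameter excludes points of P outside the interior of R, since such a point
  -- would be its own competitor at distance zero.
  have hdiam : 0 < Metric.diam P.toSet := by
    set y : EuclideanSpace ℝ (Fin n) := WithLp.toLp 2 fun i => P.corner i + P.side with hy
    have hyP : y ∈ P.toSet := fun i => ⟨by simp [hy, P.side_pos.le], by simp [hy]⟩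
    have h1 := abs_sub_le_dist y P.corner ⟨0, hn⟩
    have h2 : y ⟨0, hn⟩ - P.corner ⟨0, hn⟩ = P.side := by simp [hy]
    rw [h2, abs_of_pos P.side_pos] at h1
    exact P.side_pos.trans_le (h1.trans (Metric.dist_le_diam_of_mem P.isBounded hyP P.corner_mem))
  have hPO : P.toSet ⊆ O := by
    intro x hx
    by_contra hcon
    have := hP x hx x fun hx' => hcon (hR hx')
    rw [dist_self] at this
    linarith
  have hint : IsInteriorCube O P := by
    refine ⟨hPO, fun x hx y hy => hP x hx y fun hy' => ?_⟩
    rw [hO.frontier_eq] at hy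
    exact hy.2 (hR hy')
  have hae := ae_restrict_of_ae_restrict_of_subset (hPO.trans hOU) hfg
  rw [meanDiff_congr hae hae, ← meanOsc_eq_meanDiff]
  exact meanOsc_le_oscModulus f hint (hside.trans_lt hRt)

end Oscillation

/-! ### The quantitative estimate for the glued function. -/

section Main

/-- The quantitative form of the gluing result. -/
theorem exists_meanOsc_le_glued (n : ℕ) (hn : 1 ≤ n) {κ : ℝ} (hκ : 0 < κ) :
    ∃ (K : ℝ) (C : ℝ≥0), 0 < K ∧ 0 < C ∧
      ∀ (Ω : Set (EuclideanSpace ℝ (Fin n))) (E E' : Set (Cube n)), IsOpen Ω →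
      Bornology.IsBounded Ω → Ω.Nonempty → IsWhitney Ω E → IsWhitney (closure Ω)ᶜ E' →
      JonesCondition κ E → ∀ φ₁ φ₂ : EuclideanSpace ℝ (Fin n) → ℝ,
      AEMeasurable φ₁ (volume.restrict Ω) →
      AEMeasurable φ₂ (volume.restrict (interior (smallExterior E E'))) →
      ∀ η : ℝ≥0 → ℝ≥0, Monotone η →
      (∀ S' ∈ E', S'.toSet ⊆ smallExterior E E' →
        ∃ S, IsMatching E S' S ∧
          |(⨍ x in S.toSet, φ₁ x) - ⨍ x in S'.toSet, φ₂ x| ≤ η S'.side.toNNReal) →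
      ∀ Φ : EuclideanSpace ℝ (Fin n) → ℝ, EqOn Φ φ₁ Ω → EqOn Φ φ₂ (smallExterior E E') →
      ∀ Q : Cube n, Q.toSet ⊆ enlarged Ω E E' →
        (∃ g, Measurable g ∧ Φ =ᵐ[volume.restrict Q.toSet] g) ∧ ∀ t, Q.side < t →
        meanOsc Φ Q ≤ C * (oscModulus Ω φ₁ (K * t)
          + oscModulus (interior (smallExterior E E')) φ₂ (K * t) + η (K * t).toNNReal) := by
  obtain ⟨K, C, hK, hglue⟩ := exists_meanDiff_le_of_subset_enlarged n hn hκ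
  obtain ⟨A, hA, hmatch⟩ := exists_matching_bound n hn hκ
  obtain ⟨C₀, hC₀, hcube⟩ := exists_meanDiff_le_oscModulus n hn
  -- Matching cubes may be A times larger than their partners, so the scale is enlarged by A; the
  -- summand 1 only ensures positivity.
  refine ⟨A * K, C * C₀ + 1, by positivity, by positivity, ?_⟩
  intro Ω E E' hΩ hb hne hE hE' hJ φ₁ φ₂ hm₁ hm₂ η hη hmat Φ hΦ₁ hΦ₂ Q hQ
  set O := interior (smallExterior E E') with hO
  have hOo : IsOpen O := isOpen_interior
  have hΦO : EqOn Φ φ₂ O := hΦ₂.mono interior_subset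
  have hmΦ : AEMeasurable Φ (volume.restrict (Ω ∪ O)) := by
    rw [aemeasurable_union_iff]
    exact ⟨hm₁.congr (ae_restrict_of_forall_mem hΩ.measurableSet fun x hx => (hΦ₁ hx).symm),
      hm₂.congr (ae_restrict_of_forall_mem hOo.measurableSet fun x hx => (hΦO hx).symm)⟩
  set g := hmΦ.mk Φ with hg
  have hgm : Measurable g := hmΦ.measurable_mk
  have hU : MeasurableSet (Ω ∪ O) := (hΩ.union hOo).measurableSet
  have hΦg : Φ =ᵐ[volume.restrict (Ω ∪ O)] g := hmΦ.ae_eq_mk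
  have hg₁ : g =ᵐ[volume.restrict Ω] φ₁ :=
    EventuallyEq.trans (ae_restrict_of_ae_restrict_of_subset subset_union_left hΦg.symm)
      (ae_restrict_of_forall_mem hΩ.measurableSet hΦ₁)
  have hg₂ : g =ᵐ[volume.restrict O] φ₂ :=
    EventuallyEq.trans (ae_restrict_of_ae_restrict_of_subset subset_union_right hΦg.symm)
      (ae_restrict_of_forall_mem hOo.measurableSet hΦO)
  have hnull := volume_frontier_eq_zero hn hκ hΩ hb hne hE hJ
  have hΦQ : ∀ Q : Cube n, Q.toSet ⊆ enlarged Ω E E' → Φ =ᵐ[volume.restrict Q.toSet] g := by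
    intro Q hQ
    -- A point of the enlarged domain off the closure of Ω has a neighbourhood in Ω', so what Ω ∪ O
    -- misses lies in the null set ∂Ω.
    refine ae_restrict_eq_of_null_diff hU Q.isClosed.measurableSet hΦg
      (measure_mono_null (fun x hx => ?_) hnull)
    rw [hΩ.frontier_eq]
    refine ⟨?_, fun h => hx.2 (Or.inl h)⟩
    by_contra hcon
    refine hx.2 (Or.inr ?_)
    have hsub : enlarged Ω E E' ∩ (closure Ω)ᶜ ⊆ smallExterior E E' := fun y hy =>
      mem_smallExterior_of_mem_enlarged hy.1 hy.2
    exact interior_maximal hsub (isOpen_interior.inter isClosed_closure.isOpen_compl)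
      ⟨hQ hx.1, hcon⟩
  refine ⟨⟨g, hgm, hΦQ Q hQ⟩, fun t hQt => ?_⟩
  have ht : 0 < t := Q.side_pos.trans hQt
  have hKt : K * t ≤ A * K * t := by
    rw [mul_assoc]
    exact le_mul_of_one_le_left (by positivity) hA
  set ω₁ := oscModulus Ω φ₁ (A * K * t) with hω₁
  set ω₂ := oscModulus O φ₂ (A * K * t) with hω₂
  have hin : ∀ R : Cube n, R.toSet ⊆ Ω → R.side < A * K * t →
      meanDiff g R.toSet R.toSet ≤ C₀ * ω₁ := fun R hR hRt =>
    hcube Ω Ω hΩ hΩ.measurableSet subset_rfl φ₁ g hgm hg₁ _ R (interior_subset.trans hR) hRt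
  have hout : ∀ R : Cube n, R.toSet ⊆ smallExterior E E' → R.side < A * K * t →
      meanDiff g R.toSet R.toSet ≤ C₀ * ω₂ := fun R hR hRt =>
    hcube O O hOo hOo.measurableSet subset_rfl φ₂ g hgm hg₂ _ R (interior_mono hR) hRt
  set W : ℝ≥0∞ := C₀ * ω₁ + C₀ * ω₂ + η (A * K * t).toNNReal with hW
  have hW₁ : C₀ * ω₁ ≤ W := le_self_add.trans le_self_add
  have hW₂ : C₀ * ω₂ ≤ W := le_add_self.trans le_self_add
  have hmatW : ∀ S' ∈ E', S'.side ≤ maxSide E → S'.side < K * t →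
      ∃ S, IsMatching E S' S ∧ meanDiff g S'.toSet S.toSet ≤ W := by
    intro S' hS' hS'L hS't
    have hS'O := Cube.subset_smallExterior hS' hS'L
    obtain ⟨S, hS, hη'⟩ := hmat S' hS' hS'O
    refine ⟨S, hS, ?_⟩
    have hSΩ := hE.subset hS.1
    have hSt : S.side < A * K * t := by
      have h1 := (hmatch Ω E E' hne hE hE' hJ S' hS' S hS).1
      have h2 : A * S'.side < A * (K * t) := by gcongr
      linarith
    have e1 : ⨍ x in S.toSet, φ₁ x = ⨍ x in S.toSet, g x :=
      average_congr (ae_restrict_of_ae_restrict_of_subset hSΩ hg₁.symm)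
    -- S' need not lie in the interior O of Ω', but only a null part of its boundary can be missing.
    have e2 : ⨍ x in S'.toSet, φ₂ x = ⨍ x in S'.toSet, g x := by
      refine average_congr (ae_restrict_eq_of_null_diff hOo.measurableSet
        S'.isClosed.measurableSet hg₂.symm (measure_mono_null (fun x hx => ?_) S'.volume_frontier))
      rw [S'.isClosed.frontier_eq]
      exact ⟨hx.1, fun h => hx.2 (interior_mono hS'O h)⟩
    rw [e1, e2] at hη'
    rw [meanDiff_comm hgm]
    refine (meanDiff_le_of_average hgm S.finPos S'.finPos).trans ?_
    rw [hW]
    gcongr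
    · exact hin S hSΩ hSt
    · exact hout S' hS'O (hS't.trans_le hKt)
    · refine (ENNReal.ofReal_le_ofReal hη').trans ?_
      rw [ENNReal.ofReal_coe_nnreal]
      exact_mod_cast hη (Real.toNNReal_le_toNNReal (hS't.le.trans hKt))
  rw [meanOsc_eq_meanDiff, meanDiff_congr (hΦQ Q hQ) (hΦQ Q hQ)]
  refine (hglue Ω E E' hΩ hb hne hE hE' hJ g hgm t W
    (fun R h1 h2 => (hin R h1 (h2.trans_le hKt)).trans hW₁)
    (fun R h1 h2 => (hout R h1 (h2.trans_le hKt)).trans hW₂) hmatW Q hQ hQt).trans ?_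
  have hη₀ : (η (A * K * t).toNNReal : ℝ≥0∞) ≤ C₀ * η (A * K * t).toNNReal :=
    le_mul_of_one_le_left zero_le (by exact_mod_cast hC₀)
  calc (C : ℝ≥0∞) * W
      ≤ C * (C₀ * ω₁ + C₀ * ω₂ + C₀ * η (A * K * t).toNNReal) := by rw [hW]; gcongr
    _ = (C * C₀ : ℝ≥0∞) * (ω₁ + ω₂ + η (A * K * t).toNNReal) := by ring
    _ ≤ _ := by
      gcongr
      push_cast
      exact le_self_add

end Main

end

end WhitneyVMO

/-! ### The proposition. -/

theorem proposition3 (n : ℕ) (hn : 1 ≤ n) (κ : ℝ) (hκ : 0 < κ) :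
    ∃ C : ℝ≥0, 0 < C ∧
      ∀ (Ω : Set (EuclideanSpace ℝ (Fin n))) (E E' : Set (Cube n)),
        IsOpen Ω → IsConnected Ω → Bornology.IsBounded Ω →
        IsWhitney Ω E → IsWhitney (closure Ω)ᶜ E' → JonesCondition κ E →
        ∀ φ₁ φ₂ : EuclideanSpace ℝ (Fin n) → ℝ,
          IsVMO Ω φ₁ → IsVMO (interior (smallExterior E E')) φ₂ →
          ∀ η : ℝ≥0 → ℝ≥0, IsModulusOfContinuity η →
            (∀ S' ∈ E', S'.toSet ⊆ smallExterior E E' →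
              ∃ S, IsMatching E S' S ∧
                |(⨍ x in S.toSet, φ₁ x) - ⨍ x in S'.toSet, φ₂ x| ≤ η S'.side.toNNReal) →
            ∀ Φ : EuclideanSpace ℝ (Fin n) → ℝ,
              EqOn Φ φ₁ Ω → EqOn Φ φ₂ (smallExterior E E') →
              IsVMO (enlarged Ω E E') Φ ∧
              oscNorm (enlarged Ω E E') Φ ≤
                C * (oscNorm Ω φ₁ + oscNorm (interior (smallExterior E E')) φ₂
                  + ⨆ t, (η t : ℝ≥0∞)) := by
  obtain ⟨K, C, hK, hC, h⟩ := exists_meanOsc_le_glued n hn hκ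
  refine ⟨C, hC, ?_⟩
  intro Ω E E' hΩ hconn hb hE hE' hJ φ₁ φ₂ hφ₁ hφ₂ η hη hmat Φ hΦ₁ hΦ₂
  have hQ := h Ω E E' hΩ hb hconn.nonempty hE hE' hJ φ₁ φ₂
    hφ₁.locallyIntegrable.aestronglyMeasurable.aemeasurable
    hφ₂.locallyIntegrable.aestronglyMeasurable.aemeasurable η hη.monotone hmat Φ hΦ₁ hΦ₂
  set O := interior (smallExterior E E') with hO
  have hmod : ∀ t, oscModulus (enlarged Ω E E') Φ t ≤ C * (oscModulus Ω φ₁ (K * t)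
      + oscModulus O φ₂ (K * t) + η (K * t).toNNReal) := fun t =>
    iSup_le fun Q => iSup_le fun hQi => iSup_le fun hQt => (hQ Q hQi.1).2 t hQt
  have hbd : ∀ t, (C : ℝ≥0∞) * (oscModulus Ω φ₁ (K * t)
      + oscModulus O φ₂ (K * t) + η (K * t).toNNReal) ≤
      C * (oscNorm Ω φ₁ + oscNorm O φ₂ + ⨆ t, (η t : ℝ≥0∞)) := by
    intro t
    gcongr
    · exact le_iSup (oscModulus Ω φ₁) (K * t)
    · exact le_iSup (oscModulus O φ₂) (K * t)
    · exact le_iSup (fun t => (η t : ℝ≥0∞)) (K * t).toNNReal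
  have hfin : (C : ℝ≥0∞) * (oscNorm Ω φ₁ + oscNorm O φ₂ + ⨆ t, (η t : ℝ≥0∞)) < ⊤ := by
    refine ENNReal.mul_lt_top ENNReal.coe_lt_top (ENNReal.add_lt_top.2
      ⟨ENNReal.add_lt_top.2 ⟨hφ₁.bounded, hφ₂.bounded⟩, ?_⟩)
    exact ENNReal.iSup_coe_lt_top.2 hη.bounded
  have hnorm : oscNorm (enlarged Ω E E') Φ ≤
      C * (oscNorm Ω φ₁ + oscNorm O φ₂ + ⨆ t, (η t : ℝ≥0∞)) :=
    iSup_le fun t => (hmod t).trans (hbd t)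
  refine ⟨⟨?_, hnorm.trans_lt hfin, ?_⟩, hnorm⟩
  · intro x hx
    have hn' : (0 : ℝ) < √n := Real.sqrt_pos.2 (by exact_mod_cast hn)
    obtain ⟨ε, hε, hball⟩ := Metric.isOpen_iff.1 (isOpen_interior (s := closure Ω ∪ _)) x hx
    have hh : 0 < ε / (2 * √n) := by positivity
    set Q := cubeAt x hh with hQdef
    have hQsub : Q.toSet ⊆ enlarged Ω E E' := by
      intro y hy
      refine hball ?_
      have h1 : dist y x ≤ √n * (ε / (2 * √n)) := dist_le_sqrt_mul hh.le (mem_cubeAt.1 hy)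
      have h2 : √n * (ε / (2 * √n)) = ε / 2 := by field_simp
      rw [Metric.mem_ball]
      linarith
    obtain ⟨⟨g, hg, hΦg⟩, hosc⟩ := hQ Q hQsub
    -- Finite mean oscillation over a cube around x gives integrability there; any scale above the
    -- side will do.
    have hosc' := ((hosc (Q.side + 1) (by linarith)).trans (hbd _)).trans_lt hfin
    rw [meanOsc_eq_meanDiff, meanDiff_congr hΦg hΦg] at hosc'
    refine ⟨Q.toSet, mem_nhdsWithin_of_mem_nhds (mem_interior_iff_mem_nhds.1
      (Cube.mem_interior fun i => ?_)),
      (integrableOn_of_meanDiff_ne_top hg Q.finPos hosc'.ne).congr hΦg.symm⟩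
    simp only [hQdef, cubeAt_corner, cubeAt_side]
    constructor <;> linarith
  · have hKt : Tendsto (fun t : ℝ => K * t) (𝓝[>] 0) (𝓝[>] 0) := by
      refine tendsto_nhdsWithin_iff.2 ⟨?_, ?_⟩
      · have : Tendsto (fun t : ℝ => K * t) (𝓝 0) (𝓝 (K * 0)) := tendsto_id.const_mul K
        rw [mul_zero] at this
        exact this.mono_left nhdsWithin_le_nhds
      · filter_upwards [self_mem_nhdsWithin] with t ht
        exact mul_pos hK ht
    have hηt : Tendsto (fun t : ℝ => (η (K * t).toNNReal : ℝ≥0∞)) (𝓝[>] 0) (𝓝 0) := by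
      have h1 : Tendsto (fun t : ℝ => (K * t).toNNReal) (𝓝[>] 0) (𝓝 0) := by
        have := (continuous_real_toNNReal.tendsto 0).comp (hKt.mono_right nhdsWithin_le_nhds)
        rwa [Real.toNNReal_zero] at this
      have h2 : Tendsto η (𝓝 0) (𝓝 0) := by
        have := hη.continuousAt_zero.tendsto
        rwa [hη.map_zero] at this
      rw [← ENNReal.coe_zero]
      exact ENNReal.tendsto_coe.2 (h2.comp h1)
    have hlim : Tendsto (fun t => (C : ℝ≥0∞) * (oscModulus Ω φ₁ (K * t)
        + oscModulus O φ₂ (K * t) + η (K * t).toNNReal)) (𝓝[>] 0) (𝓝 0) := by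
      have := ENNReal.Tendsto.const_mul (a := (C : ℝ≥0∞)) (((hφ₁.vanishing.comp hKt).add
        (hφ₂.vanishing.comp hKt)).add hηt) (Or.inr ENNReal.coe_ne_top)
      simpa using this
    exact tendsto_of_tendsto_of_tendsto_of_le_of_le tendsto_const_nhds hlim
      (fun _ => zero_le) hmod
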